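/- **Setting.** For every $n$, requests for contents $i=1,\dots,n$ are described by $n$ mutually independent stationary and ergodic simple point processes $N_{n,i}$ on $\mathbb R$ (for all $n$ on a common probability space with probability $\mathbb P$), with intensities $\lambda_{n,i}\in(0,\infty)$. Let $\mathbb P^0_{n,i}$ be the Palm probability associated with $N_{n,i}$, i.e. $\mathbb P^0_{n,i}[A]=\lambda_{n,i}^{-1}\,\mathbb E\big[\sum_{s\in N_{n,i}\cap(0,1]}\mathbf 1_A(N_{n,1}-s,\dots,N_{n,n}-s)\big]$, let $G_{n,i}(t)=\mathbb P^0_{n,i}[t_{n,i}(1)\le t]$, where $t_{n,i}(1)$ is the first point of $N_{n,i}$ in $(0,\infty)$, and let $G^*_{n,i}(t)=G_{n,i}(t/\lambda_{n,i})$. Assume that all $G_{n,i}$ are continuous and that there is a continuous cdf $\Psi$ with support in $[0,\infty)$ and mean $m_\Psi>0$ such that $1-G^*_{n,i}(t)\ge 1-\Psi(t)$ for all $t,n,i$. Let $Y_{n,i}(t)=1$ if content $i$ is requested during $[-t,0)$ and $Y_{n,i}(t)=0$ otherwise, and let $Y_n(t)=\sum_{i=1}^n Y_{n,i}(t)$.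 Let $C_n\in(0,n)$ be the cache size, with $C_n\to\infty$ as $n\to\infty$, and let $\tau_n=\inf\{t:Y_n(t)\ge C_n\}$. The hit probabilities of content $i$ in an LRU cache of size $C_n$ and in a TTL cache (with reset) with timer $T$ are $H^{\mathrm{LRU}}_{n,i}=\mathbb P^0_{n,i}[Y_{n,i}(\tau_n)=1]$ and $H^{\mathrm{TTL}}_{n,i}(T)=\mathbb P^0_{n,i}[Y_{n,i}(T)=1]$. Let $T_n$ be the characteristic time, i.e. $\mathbb E[Y_n(T_n)]=C_n$. Let $p_{n,i}=\lambda_{n,i}/\sum_{j=1}^n\lambda_{n,j}$, and let $\bar P_n(k)$ be the sum of the $n-k$ smallest of the numbers $p_{n,1},\dots,p_{n,n}$. **Proposition.** Assume * (C1) there is $\beta_1\in(0,m_\Psi)$ such that $C_n\le\beta_1 n$ for all sufficiently large $n$; * (P1) there are $\kappa_1\in(1/m_\Psi,1/\beta_1)$, $\kappa_2\in[0,1)$ and $\gamma\in(0,1)$ such that $\bar P_n(\lceil\kappa_1C_n\rceil)>\gamma\,\bar P_n(\lfloor\kappa_2C_n\rfloor)$ for all sufficiently large $n$; * (R6) there are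 constants $B$ and $\rho\in(0,1]$ such that $|G^*_{n,i}(t)-G^*_{n,i}(t\pm xt)|\le Bx$ for all $x\in[0,\rho]$, all $t$ and all $n\ge i\ge1$. Then, as $n\to\infty$, $$\max_{1\le i\le n}\left|H^{\mathrm{LRU}}_{n,i}-H^{\mathrm{TTL}}_{n,i}(T_n)\right|=O\left(\sqrt{\frac{\log C_n}{C_n}}\right).$$ In particular, this conclusion holds if all request processes are (independent, homogeneous) Poisson processes with rates in $(0,\infty)$, and (C1) and (P1) hold with $m_\Psi=1$. -/

import Mathlib

open Set Filter Topology MeasureTheory ProbabilityTheory Asymptotics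
open scoped ENNReal NNReal

noncomputable section

/-! ### Simple point processes on the real line -/

/-- A locally finite subset of `ℝ`, i.e. a realization of a simple point process. -/
@[ext]
structure PointConfig where
  carrier : Set ℝ
  finite_inter : ∀ a b : ℝ, (carrier ∩ Icc a b).Finite

namespace PointConfig

/-- Number of points in `B`. -/
def count (S : PointConfig) (B : Set ℝ) : ℕ∞ := (S.carrier ∩ B).encard

/-- The σ-algebra generated by the numbers of points in Borel sets. -/
instance : MeasurableSpace PointConfig :=
  ⨆ B ∈ {B : Set ℝ | MeasurableSet B}, MeasurableSpace.comap (fun S => S.count B) ⊤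

/-- Translation of all points by `s`. -/
instance : VAdd ℝ PointConfig where
  vadd s S :=
    { carrier := (fun x => s + x) '' S.carrier
      finite_inter := by
        intro a b
        refine ((S.finite_inter (a - s) (b - s)).image (fun x => s + x)).subset ?_
        rintro _ ⟨⟨x, hx, rfl⟩, h1, h2⟩
        exact ⟨x, ⟨hx, by linarith, by linarith⟩, rfl⟩ }

/-- The first point `t(1)` in `(0, ∞)`, equal to `+∞` if there is none. -/
def nextPoint (S : PointConfig) : EReal := ⨅ s ∈ {s ∈ S.carrier | 0 < s}, (s : EReal)

/-- There is a point in `[-t, 0)`; here `t = +∞` is allowed. -/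
def RequestedIn (S : PointConfig) (t : EReal) : Prop :=
  ∃ s ∈ S.carrier, s < 0 ∧ -t ≤ (s : EReal)

end PointConfig

section Processes

variable {Ω : Type*} [MeasurableSpace Ω]

/-- The intensity of a stationary point process: the mean number of points in `(0, 1]`. -/
def intensity (P : Measure Ω) (X : Ω → PointConfig) : ℝ≥0∞ :=
  ∫⁻ ω, ((X ω).count (Ioc 0 1) : ℝ≥0∞) ∂P

/-- The intensity as a real number. -/
def rate (P : Measure Ω) (X : Ω → PointConfig) : ℝ := (intensity P X).toReal

/-- A stationary and ergodic simple point process with intensity in `(0, ∞)`. Stationarity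
(invariance of the law under all translations) is part of `ErgodicVAdd`. -/
structure IsStationaryErgodic (P : Measure Ω) (X : Ω → PointConfig) : Prop where
  measurable : Measurable X
  ergodic : ErgodicVAdd ℝ PointConfig (P.map X)
  intensity_ne_zero : intensity P X ≠ 0
  intensity_ne_top : intensity P X ≠ ⊤

/-- A homogeneous Poisson process on `ℝ` with rate `r`: numbers of points in bounded Borel sets
are Poisson with mean `r` times the Lebesgue measure, and are independent over disjoint sets. -/
structure IsPoissonProcess (P : Measure Ω) (X : Ω → PointConfig) (r : ℝ≥0) : Prop where
  measurable : Measurable X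
  count_law : ∀ B : Set ℝ, MeasurableSet B → Bornology.IsBounded B → ∀ k : ℕ,
    P {ω | (X ω).count B = k} = poissonMeasure (r * (volume B).toNNReal) {k}
  count_indep : ∀ (m : ℕ) (B : Fin m → Set ℝ), (∀ j, MeasurableSet (B j)) →
    (∀ j, Bornology.IsBounded (B j)) → Pairwise (fun j k => Disjoint (B j) (B k)) →
    iIndepFun (fun j ω => (X ω).count (B j)) P

variable {ι : Type*}

/-- The Palm probability of the event `A` associated with the `i`-th of the jointly stationary
point processes `X j`:
`λ_i⁻¹ · E[∑_{s ∈ X_i ∩ (0,1]} 1_A(all processes seen from s)]`. -/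
def palmProb (P : Measure Ω) (X : ι → Ω → PointConfig) (i : ι) (A : Set (ι → PointConfig)) :
    ℝ≥0∞ :=
  (intensity P (X i))⁻¹ *
    ∫⁻ ω, ∑' s : ↥((X i ω).carrier ∩ Ioc (0 : ℝ) 1),
      A.indicator 1 (fun j => (-(s : ℝ)) +ᵥ X j ω) ∂P

/-- `G_i(t)`: the cdf of the inter-request time of content `i` under its Palm probability. -/
def interCdf (P : Measure Ω) (X : ι → Ω → PointConfig) (i : ι) (t : ℝ) : ℝ :=
  (palmProb P X i {c | (c i).nextPoint ≤ (t : EReal)}).toReal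

/-- `G_i^*(t) = G_i(t / λ_i)`: the inter-request cdf scaled to unit mean. -/
def scaledCdf (P : Measure Ω) (X : ι → Ω → PointConfig) (i : ι) (t : ℝ) : ℝ :=
  interCdf P X i (t / rate P (X i))

/-! ### LRU and TTL caches -/

/-- `Y(t)`: the number of distinct contents requested in `[-t, 0)`. -/
def distinctCount (c : ι → PointConfig) (t : EReal) : ℕ := {j | (c j).RequestedIn t}.ncard

/-- `τ = inf {t : Y(t) ≥ C}`, equal to `+∞` if `C` distinct contents are never referenced. -/
def fillTime (C : ℝ) (c : ι → PointConfig) : EReal :=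
  ⨅ t ∈ {t : ℝ | C ≤ (distinctCount c t : ℝ)}, (t : EReal)

/-- Stationary hit probability of content `i` in an LRU cache of size `C`. -/
def hitLRU (P : Measure Ω) (X : ι → Ω → PointConfig) (C : ℝ) (i : ι) : ℝ :=
  (palmProb P X i {c | (c i).RequestedIn (fillTime C c)}).toReal

/-- Stationary hit probability of content `i` in a TTL cache (with reset) with timer `T`. -/
def hitTTL (P : Measure Ω) (X : ι → Ω → PointConfig) (T : ℝ) (i : ι) : ℝ :=
  (palmProb P X i {c | (c i).RequestedIn (T : EReal)}).toReal

/-- `K(T) = E[Y(T)]`. -/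
def expectedDistinct (P : Measure Ω) (X : ι → Ω → PointConfig) (T : ℝ) : ℝ :=
  ∫ ω, (distinctCount (fun j => X j ω) (T : EReal) : ℝ) ∂P

/-! ### Popularity -/

/-- `p_i = λ_i / ∑_j λ_j`. -/
def popularity {n : ℕ} (P : Measure Ω) (X : Fin n → Ω → PointConfig) (i : Fin n) : ℝ :=
  rate P (X i) / ∑ j, rate P (X j)

/-- The sum of all but the `k` largest of the numbers `p 0, …, p (n - 1)`: the permutation
`Tuple.sort (-p)` lists them in decreasing order. -/
def tailSum {n : ℕ} (p : Fin n → ℝ) (k : ℕ) : ℝ :=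
  ∑ j : Fin n, if k ≤ (j : ℕ) then p (Tuple.sort (fun i => -p i) j) else 0

end Processes

/-! ### The assumptions on the cache size, the popularities and the inter-request cdfs -/

/-- `C_n ≤ β₁ n` for all large `n`, where `β₁ ∈ (0, m)`. -/
def CacheSizeBound (m β₁ : ℝ) (C : ℕ → ℝ) : Prop :=
  0 < β₁ ∧ β₁ < m ∧ ∀ᶠ n : ℕ in atTop, C n ≤ β₁ * n

/-- There are `κ₁ ∈ (1/m, 1/β₁)`, `κ₂ ∈ [0, 1)` and `γ ∈ (0, 1)` such that, for all large `n`,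
`tail n ⌈κ₁ C_n⌉ > γ * tail n ⌊κ₂ C_n⌋`. -/
def HeavyTail (m β₁ : ℝ) (C : ℕ → ℝ) (tail : ℕ → ℕ → ℝ) : Prop :=
  ∃ κ₁ κ₂ γ : ℝ, κ₁ ∈ Ioo (1 / m) (1 / β₁) ∧ κ₂ ∈ Ico (0 : ℝ) 1 ∧ γ ∈ Ioo (0 : ℝ) 1 ∧
    ∀ᶠ n : ℕ in atTop, γ * tail n ⌊κ₂ * C n⌋₊ < tail n ⌈κ₁ * C n⌉₊

/-- The relative Lipschitz condition `|G(t) - G(t ± xt)| ≤ Bx` for `x ∈ [0, ρ]`, uniformly over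
a family of functions. -/
def RelativeLipschitz (𝒢 : Set (ℝ → ℝ)) : Prop :=
  ∃ B ρ : ℝ, 0 < ρ ∧ ρ ≤ 1 ∧ ∀ G ∈ 𝒢, ∀ x ∈ Icc 0 ρ, ∀ t : ℝ,
    |G t - G (t + x * t)| ≤ B * x ∧ |G t - G (t - x * t)| ≤ B * x

end

noncomputable section

/-! ### Point configurations: measurability, shifts and the counting kernel. -/

namespace PointConfig

/-! Write $q_j$ for `requestProb`, $H_j$ for `hitTTL` and $K(t)=\sum_j q_j(t)$ for the mean number
of distinct contents requested in $[-t,0)$, so that $K(T_n)=C_n$. The LRU cache behaves like a TTL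
cache with the random timer $\tau_n$, and the proof shows that $\tau_n$ lies in
$[T_n(1-x),T_n(1+x)]$ with high Palm probability, for some $x$ of order $\sqrt{\log C_n/C_n}$.

Concentration. $Y_n(t)$ is a sum of independent indicators. Seen from a point of $N_{n,i}$ the other
processes keep their law (`palmProb_le_of_forall_measure_le`), so a Chernoff bound applies under
$\mathbb P^0_{n,i}$ after content $i$ is dropped. If $K(t)$ differs from $C$ by $2d$, then $\tau$ is
on the expected side of $t$ up to probability $e^{-d^2/(8C)}$ (`hitTTL_sub_le_hitLRU`,
`hitLRU_le_hitTTL_add`).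

Growth of $K$. Palm calculus gives $q_j'=\lambda_j(1-H_j)$ in the form of finite differences
(`rate_mul_le_requestProb_sub`). A content with $\lambda_jT\ge z$ has
$q_j(T)\ge\int_0^z(1-\Psi)=1/\kappa_1$; since the $q_j(T)$ add up to $C$, there are at most
$\kappa_1C$ of these. Also $C\le\kappa_2C+\Lambda T\,\bar P(\lfloor\kappa_2C\rfloor)$ with
$\Lambda=\sum_j\lambda_j$, because $q_j\le\min(1,\lambda_jT)$. With (P1), the contents with
$\lambda_jT<z$ satisfy $\sum\lambda_jT\ge\gamma(1-\kappa_2)C$ (`mul_le_sum_rate_mul`). Their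
survival functions are bounded below near $T$, so $K(T(1\pm x))$ differs from $C$ by at least
$c\,x\,C$.

Conclusion. Choose $x$ so that $cxC=2d$ with $d=3\sqrt{C\log C}$. The relative Lipschitz condition
bounds the change of $H_i$ between $T$ and $T(1\pm x)$ by $Bx$ (`isBigO_iSup_hitLRU_sub_hitTTL`). It
is applied to $G_i$ because $H_i=G_i$ (`hitTTL_eq_interCdf`). For Poisson processes all these
quantities are explicit. -/

theorem measurableSet_preimage_count {B : Set ℝ} (hB : MeasurableSet B) (s : Set ℕ∞) :
    MeasurableSet ((fun S : PointConfig => S.count B) ⁻¹' s) := by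
  have h : MeasurableSpace.comap (fun S : PointConfig => S.count B) ⊤ ≤
      (inferInstance : MeasurableSpace PointConfig) :=
    le_iSup₂_of_le (f := fun B (_ : B ∈ {B : Set ℝ | MeasurableSet B}) =>
      MeasurableSpace.comap (fun S : PointConfig => S.count B) ⊤) B hB le_rfl
  exact h _ ⟨s, trivial, rfl⟩

theorem measurable_count {B : Set ℝ} (hB : MeasurableSet B) :
    Measurable fun S : PointConfig => ((S.count B : ℕ∞) : ℝ≥0∞) :=
  fun s _ => measurableSet_preimage_count hB ((fun k : ℕ∞ => (k : ℝ≥0∞)) ⁻¹' s)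

theorem measurableSet_count_eq {B : Set ℝ} (hB : MeasurableSet B) (k : ℕ∞) :
    MeasurableSet {S : PointConfig | S.count B = k} :=
  measurableSet_preimage_count hB {k}

theorem measurable_of_count {α : Type*} [MeasurableSpace α] {f : α → PointConfig}
    (h : ∀ B : Set ℝ, MeasurableSet B →
      Measurable fun a => (((f a).count B : ℕ∞) : ℝ≥0∞)) : Measurable f := by
  refine Measurable.of_le_map ?_
  refine iSup₂_le fun B hB => ?_
  rintro _ ⟨s, -, rfl⟩
  -- Every subset of `ℕ∞` has a countable, hence measurable, image in `ℝ≥0∞`, so nothing is lost by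
  -- testing counts there, where the lemmas on integrals apply.
  have hs : MeasurableSet ((fun k : ℕ∞ => (k : ℝ≥0∞)) '' s) :=
    (s.to_countable.image _).measurableSet
  have := h B hB hs
  rw [MeasurableSpace.map_def]
  convert this using 1
  ext a
  simp

/-- The counting measure on the points of a configuration. -/
def points (S : PointConfig) : Measure ℝ := Measure.sum fun s : S.carrier => Measure.dirac (s : ℝ)

theorem lintegral_points (S : PointConfig) (f : ℝ → ℝ≥0∞) :
    ∫⁻ x, f x ∂S.points = ∑' s : S.carrier, f s := by
  simp [points, lintegral_sum_measure, lintegral_dirac]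

theorem points_apply (S : PointConfig) {B : Set ℝ} (hB : MeasurableSet B) :
    S.points B = ((S.count B : ℕ∞) : ℝ≥0∞) := by
  rw [← lintegral_indicator_one hB, lintegral_points, tsum_subtype S.carrier (B.indicator 1),
    count, ← ENNReal.tsum_set_one, tsum_subtype (S.carrier ∩ B) (fun _ => 1), indicator_indicator]
  rfl

theorem setLIntegral_points (S : PointConfig) {B : Set ℝ} (hB : MeasurableSet B)
    (f : ℝ → ℝ≥0∞) :
    ∫⁻ x in B, f x ∂S.points = ∑' s : ↥(S.carrier ∩ B), f s := by
  rw [← lintegral_indicator hB, lintegral_points, tsum_subtype S.carrier (B.indicator f),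
    tsum_subtype (S.carrier ∩ B) f, indicator_indicator]

theorem count_ne_top (S : PointConfig) {B : Set ℝ} (hB : Bornology.IsBounded B) :
    S.count B ≠ ⊤ := by
  obtain ⟨a, b, h⟩ := bddBelow_bddAbove_iff_subset_Icc.1 (isBounded_iff_bddBelow_bddAbove.1 hB)
  rw [count, encard_ne_top_iff]
  exact (S.finite_inter a b).subset (inter_subset_inter_right _ h)

/-- The counting measures as a kernel. -/
def pointKernel : Kernel PointConfig ℝ where
  toFun := points
  measurable' := Measure.measurable_of_measurable_coe _ fun B hB => by
    simp_rw [points_apply _ hB]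
    exact measurable_count hB

open Classical in
/-- The points in `(k, k + 1]`, for configurations with exactly `m` of these. -/
def pointKernelPiece (q : ℤ × ℕ) : Kernel PointConfig ℝ :=
  Kernel.piecewise (s := {S | S.count (Ioc (q.1 : ℝ) (q.1 + 1)) = q.2})
    (measurableSet_count_eq measurableSet_Ioc _)
    (pointKernel.restrict (measurableSet_Ioc : MeasurableSet (Ioc (q.1 : ℝ) (q.1 + 1)))) 0

instance (q : ℤ × ℕ) : IsFiniteKernel (pointKernelPiece q) where
  exists_univ_le := by
    refine ⟨q.2, ENNReal.natCast_lt_top _, fun S => ?_⟩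
    rw [pointKernelPiece, Kernel.piecewise_apply]
    split_ifs with h
    · rw [Kernel.restrict_apply, Measure.restrict_apply_univ]
      change S.points _ ≤ _
      rw [points_apply _ measurableSet_Ioc]
      simp only [mem_ofPred_eq] at h
      rw [h]
      simp
    · simp

/-- Counts have no uniform bound, so the kernel is not finite. Splitting by unit cell and by the
number of points in it gives countably many finite pieces, hence s-finiteness, which Fubini needs.
-/
theorem pointKernel_eq_sum : pointKernel = Kernel.sum pointKernelPiece := by
  ext S B hB
  rw [Kernel.sum_apply, Measure.sum_apply _ hB, ENNReal.tsum_prod']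
  have h (k : ℤ) : ∑' m : ℕ, pointKernelPiece (k, m) S B = S.points (B ∩ Ioc (k : ℝ) (k + 1)) := by
    obtain ⟨m, hm⟩ := ENat.ne_top_iff_exists.1
      (S.count_ne_top (Metric.isBounded_Ioc (k : ℝ) (k + 1)))
    rw [tsum_eq_single m]
    · rw [pointKernelPiece, Kernel.piecewise_apply, if_pos (by simp [← hm]), Kernel.restrict_apply,
        Measure.restrict_apply hB]
      rfl
    · intro m' hm'
      rw [pointKernelPiece, Kernel.piecewise_apply, if_neg]
      · simp
      · simpa [← hm] using hm'.symm
  simp_rw [h]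
  rw [← measure_iUnion]
  · rw [← inter_iUnion, iUnion_Ioc_intCast, inter_univ]
    rfl
  · intro i j hij
    exact ((pairwise_disjoint_Ioc_intCast ℝ) hij).mono inter_subset_right inter_subset_right
  · exact fun k => hB.inter measurableSet_Ioc

instance : IsSFiniteKernel pointKernel := by
  rw [pointKernel_eq_sum]
  infer_instance

instance (S : PointConfig) : SFinite S.points :=
  inferInstanceAs (SFinite (pointKernel S))

theorem carrier_vadd (t : ℝ) (S : PointConfig) :
    (t +ᵥ S).carrier = (fun x => t + x) '' S.carrier := rfl

theorem mem_vadd {t x : ℝ} {S : PointConfig} : x ∈ (t +ᵥ S).carrier ↔ x - t ∈ S.carrier := by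
  rw [carrier_vadd]
  constructor
  · rintro ⟨y, hy, rfl⟩
    simpa using hy
  · exact fun h => ⟨_, h, by simp⟩

theorem vadd_vadd' (s t : ℝ) (S : PointConfig) : s +ᵥ (t +ᵥ S) = (s + t) +ᵥ S := by
  ext x
  rw [mem_vadd, mem_vadd, mem_vadd, sub_sub]

theorem lintegral_points_vadd (t : ℝ) (S : PointConfig) (f : ℝ → ℝ≥0∞) :
    ∫⁻ x, f x ∂(t +ᵥ S).points = ∫⁻ x, f (t + x) ∂S.points := by
  rw [lintegral_points, lintegral_points]
  exact tsum_image (f := f) (add_right_injective t).injOn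

/-- A count of the shifted configuration is the integral of a jointly measurable function against
the counting kernel. -/
theorem measurable_vadd : Measurable fun q : ℝ × PointConfig => q.1 +ᵥ q.2 := by
  refine measurable_of_count fun B hB => ?_
  have h (q : ℝ × PointConfig) : (((q.1 +ᵥ q.2).count B : ℕ∞) : ℝ≥0∞) =
      ∫⁻ x, B.indicator 1 (q.1 + x) ∂q.2.points := by
    rw [← points_apply _ hB, ← lintegral_indicator_one hB, lintegral_points_vadd]
  simp_rw [h]
  let κ : Kernel (ℝ × PointConfig) ℝ := pointKernel.comap Prod.snd measurable_snd
  refine Measurable.lintegral_kernel_prod_right (κ := κ) (f := fun (q : ℝ × PointConfig) x =>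
    B.indicator (1 : ℝ → ℝ≥0∞) (q.1 + x)) ?_
  exact (measurable_one.indicator hB).comp (measurable_fst.fst.add measurable_snd)

theorem measurable_vadd_const (t : ℝ) : Measurable fun S : PointConfig => t +ᵥ S :=
  measurable_vadd.comp measurable_prodMk_left

theorem count_ne_zero {S : PointConfig} {B : Set ℝ} :
    S.count B ≠ 0 ↔ (S.carrier ∩ B).Nonempty := by
  rw [count, encard_ne_zero]

theorem requestedIn_iff {S : PointConfig} {t : ℝ} :
    S.RequestedIn t ↔ (S.carrier ∩ Ico (-t) 0).Nonempty := by
  constructor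
  · rintro ⟨s, hs, h0, ht⟩
    exact ⟨s, hs, by exact_mod_cast ht, h0⟩
  · rintro ⟨s, hs, ht, h0⟩
    exact ⟨s, hs, h0, by exact_mod_cast ht⟩

theorem measurableSet_inter_nonempty {B : Set ℝ} (hB : MeasurableSet B) :
    MeasurableSet {S : PointConfig | (S.carrier ∩ B).Nonempty} := by
  simp_rw [← count_ne_zero]
  exact measurableSet_preimage_count hB {0}ᶜ

theorem measurableSet_requestedIn (t : ℝ) :
    MeasurableSet {S : PointConfig | S.RequestedIn t} := by
  simp_rw [requestedIn_iff]
  exact measurableSet_inter_nonempty measurableSet_Ico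

theorem RequestedIn.mono {S : PointConfig} {s t : EReal} (hst : s ≤ t) (h : S.RequestedIn s) :
    S.RequestedIn t := by
  obtain ⟨x, hx, h0, hs⟩ := h
  exact ⟨x, hx, h0, (EReal.neg_le_neg_iff.2 hst).trans hs⟩

theorem finite_inter_of_isBounded (S : PointConfig) {B : Set ℝ} (hB : Bornology.IsBounded B) :
    (S.carrier ∩ B).Finite :=
  encard_ne_top_iff.1 (S.count_ne_top hB)

theorem exists_isLeast {S : PointConfig} {B : Set ℝ} (hB : Bornology.IsBounded B)
    (h : (S.carrier ∩ B).Nonempty) : ∃ x, IsLeast (S.carrier ∩ B) x := by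
  obtain ⟨x, hx, hmin⟩ := exists_min_image _ id (S.finite_inter_of_isBounded hB) h
  exact ⟨x, hx, hmin⟩

theorem exists_isGreatest {S : PointConfig} {B : Set ℝ} (hB : Bornology.IsBounded B)
    (h : (S.carrier ∩ B).Nonempty) : ∃ x, IsGreatest (S.carrier ∩ B) x := by
  obtain ⟨x, hx, hmax⟩ := exists_max_image _ id (S.finite_inter_of_isBounded hB) h
  exact ⟨x, hx, hmax⟩

theorem nextPoint_le_iff {S : PointConfig} {t : ℝ} :
    S.nextPoint ≤ t ↔ (S.carrier ∩ Ioc 0 t).Nonempty := by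
  constructor
  · intro h
    -- Slack makes the inequality strict, so that some point lies below it; local finiteness then
    -- yields a least positive point, which is the infimum.
    have h1 : S.nextPoint < ((t + 1 : ℝ) : EReal) :=
      h.trans_lt (by exact_mod_cast lt_add_one t)
    rw [nextPoint, iInf_lt_iff] at h1
    obtain ⟨s, hs⟩ := h1
    rw [iInf_lt_iff] at hs
    obtain ⟨⟨hs, hs0⟩, hst⟩ := hs
    obtain ⟨x, hx, hxe⟩ := exists_isLeast (S := S) (Metric.isBounded_Ioc 0 s) ⟨s, hs, hs0, le_rfl⟩
    refine ⟨x, hx.1, hx.2.1, ?_⟩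
    have : (x : EReal) ≤ S.nextPoint := by
      refine le_iInf₂ fun y hy => ?_
      by_contra! hyx
      have hyx' : y < x := by exact_mod_cast hyx
      exact hyx'.not_ge (hxe ⟨hy.1, hy.2, hyx'.le.trans hx.2.2⟩)
    exact_mod_cast this.trans h
  · rintro ⟨x, hx, h0, hxt⟩
    exact (iInf₂_le x ⟨hx, h0⟩).trans (by exact_mod_cast hxt)

end PointConfig

/-! ### Stationary point processes and their Palm measures. -/

variable {Ω : Type*} [MeasurableSpace Ω]

/-- A stationary point process with intensity in `(0, ∞)`. -/
structure IsStationaryPointProcess (P : Measure Ω) (X : Ω → PointConfig) : Prop where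
  measurable : Measurable X
  map_vadd : ∀ t : ℝ, P.map (fun ω => t +ᵥ X ω) = P.map X
  intensity_ne_zero : intensity P X ≠ 0
  intensity_ne_top : intensity P X ≠ ⊤

namespace PointConfig

theorem measurable_count_inter {A : Set PointConfig} (hA : MeasurableSet A) {B : Set ℝ}
    (hB : MeasurableSet B) :
    Measurable fun S : PointConfig => ((S.count (B ∩ {s | -s +ᵥ S ∈ A}) : ℕ∞) : ℝ≥0∞) := by
  have hm : MeasurableSet {q : PointConfig × ℝ | q.2 ∈ B ∧ -q.2 +ᵥ q.1 ∈ A} :=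
    (measurable_snd hB).inter
      ((measurable_vadd.comp (measurable_snd.neg.prodMk measurable_fst)) hA)
  convert Kernel.measurable_kernel_prodMk_left (κ := pointKernel) hm using 2 with S
  exact (points_apply S (measurable_prodMk_left hm)).symm

theorem measurableSet_vadd_mem {A : Set PointConfig} (hA : MeasurableSet A) (S : PointConfig) :
    MeasurableSet {s : ℝ | -s +ᵥ S ∈ A} :=
  (measurable_vadd.comp (measurable_neg.prodMk measurable_const)) hA

/-- What is seen from a point does not change when everything is shifted together; this makes
`palmMeasure` translation invariant. -/
theorem count_inter_vadd (t : ℝ) (S : PointConfig) (A : Set PointConfig) (B : Set ℝ) :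
    (t +ᵥ S).count (B ∩ {s | -s +ᵥ (t +ᵥ S) ∈ A}) =
      S.count ((fun x => t + x) ⁻¹' B ∩ {s | -s +ᵥ S ∈ A}) := by
  rw [count, count,
    ← (add_right_injective t).encard_image (S.carrier ∩ ((fun x => t + x) ⁻¹' B ∩ _))]
  congr 1
  ext x
  constructor
  · rintro ⟨h1, h2, h3⟩
    rw [mem_vadd] at h1
    rw [mem_ofPred_eq, vadd_vadd'] at h3
    refine ⟨x - t, ⟨h1, ?_, ?_⟩, add_sub_cancel t x⟩
    · rwa [mem_preimage, add_sub_cancel]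
    · rwa [mem_ofPred_eq, neg_sub, sub_eq_neg_add, add_comm, ← sub_eq_add_neg,
        ← neg_add_eq_sub]
  · rintro ⟨y, ⟨h1, h2, h3⟩, rfl⟩
    refine ⟨mem_vadd.2 (by rwa [add_sub_cancel_left]), h2, ?_⟩
    rwa [mem_ofPred_eq, vadd_vadd', neg_add_rev, neg_add_cancel_right]

end PointConfig

open PointConfig

theorem IsStationaryPointProcess.lintegral_vadd {P : Measure Ω} {X : Ω → PointConfig}
    (hX : IsStationaryPointProcess P X) (t : ℝ) {f : PointConfig → ℝ≥0∞} (hf : Measurable f) :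
    ∫⁻ ω, f (t +ᵥ X ω) ∂P = ∫⁻ ω, f (X ω) ∂P := by
  rw [← lintegral_map hf hX.measurable, ← hX.map_vadd t,
    lintegral_map (g := fun ω => t +ᵥ X ω) hf ((measurable_vadd_const t).comp hX.measurable)]

theorem IsStationaryPointProcess.measure_vadd {P : Measure Ω} {X : Ω → PointConfig}
    (hX : IsStationaryPointProcess P X) (t : ℝ) {A : Set PointConfig} (hA : MeasurableSet A) :
    P {ω | t +ᵥ X ω ∈ A} = P {ω | X ω ∈ A} := by
  have h1 := Measure.map_apply (μ := P) hX.measurable hA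
  have h2 := Measure.map_apply (μ := P) ((measurable_vadd_const t).comp hX.measurable) hA
  rw [← hX.map_vadd t] at h1
  exact h2.symm.trans h1

/-- The mean number of points in a set from which the process is seen in `A`. -/
def palmMeasure (P : Measure Ω) (X : Ω → PointConfig) (A : Set PointConfig) : Measure ℝ :=
  ((P.map X ⊗ₘ pointKernel).restrict {q | -q.2 +ᵥ q.1 ∈ A}).map Prod.snd

section Palm

variable {P : Measure Ω} [IsProbabilityMeasure P] {X : Ω → PointConfig} {A : Set PointConfig}

theorem palmMeasure_apply (hX : Measurable X) (hA : MeasurableSet A) {B : Set ℝ}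
    (hB : MeasurableSet B) :
    palmMeasure P X A B = ∫⁻ ω, ((X ω).count (B ∩ {s | -s +ᵥ X ω ∈ A}) : ℝ≥0∞) ∂P := by
  have hm : MeasurableSet {q : PointConfig × ℝ | -q.2 +ᵥ q.1 ∈ A} :=
    (measurable_vadd.comp (measurable_snd.neg.prodMk measurable_fst)) hA
  rw [palmMeasure, Measure.map_apply measurable_snd hB,
    Measure.restrict_apply (measurable_snd hB),
    Measure.compProd_apply ((measurable_snd hB).inter hm),
    ← lintegral_map (measurable_count_inter hA hB) hX]
  exact lintegral_congr fun S => points_apply S (measurable_prodMk_left ((measurable_snd hB).inter hm))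

theorem palmMeasure_le (hX : Measurable X) (hA : MeasurableSet A) :
    palmMeasure P X A (Ioc 0 1) ≤ intensity P X := by
  rw [palmMeasure_apply hX hA measurableSet_Ioc]
  refine lintegral_mono fun ω => ENat.toENNReal_mono (encard_le_encard ?_)
  exact inter_subset_inter_right _ inter_subset_left

theorem palmMeasure_add_compl (hX : Measurable X) (hA : MeasurableSet A) :
    palmMeasure P X A (Ioc 0 1) + palmMeasure P X Aᶜ (Ioc 0 1) = intensity P X := by
  rw [palmMeasure_apply hX hA measurableSet_Ioc, palmMeasure_apply hX hA.compl measurableSet_Ioc,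
    intensity, ← lintegral_add_left (f := fun ω => (((X ω).count
      (Ioc 0 1 ∩ {s | -s +ᵥ X ω ∈ A}) : ℕ∞) : ℝ≥0∞))
      ((measurable_count_inter hA measurableSet_Ioc).comp hX)]
  refine lintegral_congr fun ω => ?_
  have hm := measurableSet_vadd_mem hA (X ω)
  rw [← points_apply _ (measurableSet_Ioc.inter hm), ← points_apply _ measurableSet_Ioc,
    ← points_apply _ (measurableSet_Ioc.inter (measurableSet_vadd_mem hA.compl (X ω)))]
  exact measure_inter_add_sdiff _ hm

theorem IsStationaryPointProcess.isAddLeftInvariant_palmMeasure (hX : IsStationaryPointProcess P X)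
    (hA : MeasurableSet A) : (palmMeasure P X A).IsAddLeftInvariant where
  map_add_left_eq_self t := by
    ext B hB
    have ht : Measurable fun x : ℝ => t + x := measurable_const_add t
    rw [Measure.map_apply ht hB, palmMeasure_apply hX.measurable hA (ht hB),
      palmMeasure_apply hX.measurable hA hB]
    simp_rw [← count_inter_vadd]
    exact hX.lintegral_vadd t (measurable_count_inter hA hB)

/-- A locally finite translation invariant measure on $\mathbb R$ is a multiple of Lebesgue measure.
Palm probabilities can therefore be computed from any window, such as $[-h,0)$ or a long $(0,m]$. -/
theorem IsStationaryPointProcess.palmMeasure_eq (hX : IsStationaryPointProcess P X) (hA : MeasurableSet A) (B : Set ℝ) :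
    palmMeasure P X A B = palmMeasure P X A (Ioc 0 1) * volume B := by
  have := hX.isAddLeftInvariant_palmMeasure hA
  have : IsLocallyFiniteMeasure (palmMeasure P X A) := by
    refine ⟨fun x => ⟨Ioc (x - 1 / 2) (x + 1 / 2), Ioc_mem_nhds (by linarith) (by linarith), ?_⟩⟩
    have h := measure_preimage_add (palmMeasure P X A) (-(x - 1 / 2)) (Ioc 0 1)
    rw [preimage_const_add_Ioc, sub_neg_eq_add, zero_add, sub_neg_eq_add,
      show 1 + (x - 1 / 2) = x + 1 / 2 by ring] at h
    rw [h]
    exact (palmMeasure_le hX.measurable hA).trans_lt hX.intensity_ne_top.lt_top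
  have h := Measure.isAddLeftInvariant_eq_smul (palmMeasure P X A) volume
  set k := (palmMeasure P X A).addHaarScalarFactor volume
  have h1 (B : Set ℝ) : palmMeasure P X A B = (k : ℝ≥0∞) * volume B := by
    rw [h]
    rfl
  rw [h1, h1, Real.volume_Ioc, sub_zero, ENNReal.ofReal_one, mul_one]

theorem palmProb_coord {ι : Type*} {X : ι → Ω → PointConfig} {i : ι} (hX : Measurable (X i))
    (hA : MeasurableSet A) :
    palmProb P X i {c | c i ∈ A} =
      (intensity P (X i))⁻¹ * palmMeasure P (X i) A (Ioc 0 1) := by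
  rw [palmProb, palmMeasure_apply hX hA measurableSet_Ioc]
  congr 1
  refine lintegral_congr fun ω => ?_
  rw [← points_apply _ (measurableSet_Ioc.inter (measurableSet_vadd_mem hA _)),
    inter_comm (Ioc (0 : ℝ) 1) {s | _}, ← Measure.restrict_apply (measurableSet_vadd_mem hA _),
    ← lintegral_indicator_one (measurableSet_vadd_mem hA _),
    setLIntegral_points _ measurableSet_Ioc]
  rfl

/-- The mean number of points in a set from which the process is seen in `A`, in terms of the Palm
probability of `A`. -/
theorem IsStationaryPointProcess.palmMeasure_toReal {ι : Type*} {X : ι → Ω → PointConfig} {i : ι}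
    (hX : IsStationaryPointProcess P (X i)) (hA : MeasurableSet A) {a b : ℝ} (hab : a ≤ b) :
    (palmMeasure P (X i) A (Ico a b)).toReal =
      rate P (X i) * (palmProb P X i {c | c i ∈ A}).toReal * (b - a) := by
  rw [hX.palmMeasure_eq hA, palmProb_coord hX.measurable hA, rate, ENNReal.toReal_mul,
    ENNReal.toReal_mul, ENNReal.toReal_inv, Real.volume_Ico,
    ENNReal.toReal_ofReal (sub_nonneg.2 hab)]
  have := ENNReal.toReal_ne_zero.2 ⟨hX.intensity_ne_zero, hX.intensity_ne_top⟩
  field_simp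

theorem IsStationaryPointProcess.palmProb_ne_top {ι : Type*} {X : ι → Ω → PointConfig} {i : ι}
    (hX : IsStationaryPointProcess P (X i)) (hA : MeasurableSet A) :
    palmProb P X i {c | c i ∈ A} ≠ ⊤ := by
  rw [palmProb_coord hX.measurable hA]
  exact ENNReal.mul_ne_top (ENNReal.inv_ne_top.2 hX.intensity_ne_zero)
    ((palmMeasure_le hX.measurable hA).trans_lt hX.intensity_ne_top.lt_top).ne

theorem IsStationaryPointProcess.palmProb_compl {ι : Type*} {X : ι → Ω → PointConfig} {i : ι}
    (hX : IsStationaryPointProcess P (X i)) (hA : MeasurableSet A) :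
    (palmProb P X i {c | c i ∈ Aᶜ}).toReal = 1 - (palmProb P X i {c | c i ∈ A}).toReal := by
  rw [eq_sub_iff_add_eq, add_comm, ← ENNReal.toReal_add (hX.palmProb_ne_top hA)
    (hX.palmProb_ne_top hA.compl), palmProb_coord hX.measurable hA,
    palmProb_coord hX.measurable hA.compl, ← mul_add, palmMeasure_add_compl hX.measurable hA,
    ENNReal.inv_mul_cancel hX.intensity_ne_zero hX.intensity_ne_top, ENNReal.toReal_one]

omit [IsProbabilityMeasure P] in
theorem IsStationaryPointProcess.rate_pos (hX : IsStationaryPointProcess P X) : 0 < rate P X :=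
  ENNReal.toReal_pos hX.intensity_ne_zero hX.intensity_ne_top

end Palm

/-- The probability of a request in `[-t, 0)`. -/
def requestProb (P : Measure Ω) (X : Ω → PointConfig) (t : ℝ) : ℝ :=
  P.real {ω | (X ω).RequestedIn (t : EReal)}

/-! ### Gaps before and after points, and the Palm formulas for request probabilities. -/

namespace PointConfig

theorem not_requestedIn_neg_vadd_iff {S : PointConfig} {s u : ℝ} :
    ¬ (-s +ᵥ S).RequestedIn u ↔ ∀ x ∈ S.carrier, s - u ≤ x → s ≤ x := by
  rw [requestedIn_iff, not_nonempty_iff_eq_empty, eq_empty_iff_forall_notMem]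
  constructor
  · intro h x hx hxs
    by_contra! hlt
    exact h (x - s) ⟨mem_vadd.2 (by rwa [sub_neg_eq_add, sub_add_cancel]), by linarith,
      by linarith⟩
  · rintro h x ⟨hx, hx1, hx2⟩
    have := h _ (mem_vadd.1 hx) (by linarith)
    linarith

theorem not_nextPoint_neg_vadd_le_iff {S : PointConfig} {s u : ℝ} :
    ¬ (-s +ᵥ S).nextPoint ≤ u ↔ ∀ x ∈ S.carrier, s < x → s + u < x := by
  rw [nextPoint_le_iff, not_nonempty_iff_eq_empty, eq_empty_iff_forall_notMem]
  constructor
  · intro h x hx hxs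
    by_contra! hlt
    exact h (x - s) ⟨mem_vadd.2 (by rwa [sub_neg_eq_add, sub_add_cancel]), by linarith,
      by linarith⟩
  · rintro h x ⟨hx, hx1, hx2⟩
    have := h _ (mem_vadd.1 hx) (by linarith)
    linarith

theorem measurableSet_nextPoint_le (t : ℝ) :
    MeasurableSet {S : PointConfig | S.nextPoint ≤ t} := by
  simp_rw [nextPoint_le_iff]
  exact measurableSet_inter_nonempty measurableSet_Ioc

/-- Two points of $[-h,0)$ are less than $h\le t+h$ apart, so at most one of them has an empty
look-back window of length $t+h$. If there is one, then $[-t-h,-h)$ is empty. -/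
theorem count_le_indicator (S : PointConfig) {t h : ℝ} (ht : 0 ≤ t) :
    S.count (Ico (-h) 0 ∩ {s | ¬ (-s +ᵥ S).RequestedIn (t + h : ℝ)}) ≤
      {S : PointConfig | S.RequestedIn (t + h : ℝ) ∧ ¬ (h +ᵥ S).RequestedIn t}.indicator 1 S := by
  set R := S.carrier ∩ (Ico (-h) 0 ∩ {s | ¬ (-s +ᵥ S).RequestedIn (t + h : ℝ)})
  by_cases hR : R.Nonempty
  · obtain ⟨s, hs, hs0, hsR⟩ := hR
    rw [mem_ofPred_eq, not_requestedIn_neg_vadd_iff] at hsR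
    rw [indicator_of_mem]
    · refine encard_le_one_iff.2 ?_
      rintro x y ⟨hx, hx0, hxR⟩ ⟨hy, hy0, hyR⟩
      rw [mem_ofPred_eq, not_requestedIn_neg_vadd_iff] at hxR hyR
      exact le_antisymm (hxR y hy (by linarith [hx0.2, hy0.1]))
        (hyR x hx (by linarith [hy0.2, hx0.1]))
    · refine ⟨requestedIn_iff.2 ⟨s, hs, by linarith [hs0.1], hs0.2⟩, ?_⟩
      rw [← neg_neg h, not_requestedIn_neg_vadd_iff]
      intro x hx hxt
      exact hs0.1.trans (hsR x hx (by linarith [hs0.2]))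
  · rw [not_nonempty_iff_eq_empty] at hR
    change R.encard ≤ _
    rw [hR, encard_empty]
    exact zero_le

/-- The first point of $[-h,0)$ is preceded by a gap of length at least $t$. The shorter look-back
is the only loss against `count_le_indicator`. -/
theorem indicator_le_count (S : PointConfig) (t h : ℝ) :
    {S : PointConfig | S.RequestedIn (t + h : ℝ) ∧ ¬ (h +ᵥ S).RequestedIn t}.indicator 1 S ≤
      S.count (Ico (-h) 0 ∩ {s | ¬ (-s +ᵥ S).RequestedIn t}) := by
  refine indicator_apply_le' ?_ fun _ => zero_le
  rintro ⟨h1, h2⟩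
  rw [← neg_neg h, not_requestedIn_neg_vadd_iff] at h2
  rw [requestedIn_iff] at h1
  have hsub : S.carrier ∩ Ico (-(t + h)) 0 ⊆ S.carrier ∩ Ico (-h) 0 :=
    fun x hx => ⟨hx.1, h2 x hx.1 (by linarith [hx.2.1]), hx.2.2⟩
  obtain ⟨s, hs, hmin⟩ := exists_isLeast (Metric.isBounded_Ico _ _) (h1.mono hsub)
  refine one_le_encard_iff_nonempty.2 ⟨s, hs.1, hs.2, ?_⟩
  rw [mem_ofPred_eq, not_requestedIn_neg_vadd_iff]
  intro x hx hxt
  have hxh := h2 x hx (by linarith [hs.2.1])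
  by_contra! hlt
  exact hlt.not_ge (hmin ⟨hx, hxh, hlt.trans hs.2.2⟩)

/-- Send a point followed by a long gap to its successor, which is preceded by that gap. This is
injective, and only the last point of the window has no successor in it. -/
theorem encard_isolated_right_le (S : PointConfig) (m u : ℝ) :
    S.count (Ioc 0 m ∩ {s | ¬ (-s +ᵥ S).nextPoint ≤ u}) ≤
      S.count (Ioc 0 m ∩ {s | ¬ (-s +ᵥ S).RequestedIn u}) + 1 := by
  set R := S.carrier ∩ (Ioc 0 m ∩ {s | ¬ (-s +ᵥ S).nextPoint ≤ u})
  set R₁ := {s ∈ R | (S.carrier ∩ Ioc s m).Nonempty}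
  set R₂ := {s ∈ R | S.carrier ∩ Ioc s m = ∅}
  have hR : R ⊆ R₁ ∪ R₂ := fun s hs =>
    (S.carrier ∩ Ioc s m).eq_empty_or_nonempty.elim (fun h => .inr ⟨hs, h⟩) fun h => .inl ⟨hs, h⟩
  refine (encard_le_encard hR).trans ((encard_union_le _ _).trans (add_le_add ?_ ?_))
  · have h (s : R₁) : ∃ x, IsLeast (S.carrier ∩ Ioc s m) x :=
      exists_isLeast (Metric.isBounded_Ioc _ _) s.2.2
    choose f hf using h
    refine Function.Embedding.encard_le ⟨fun s => ⟨f s, ?_⟩, ?_⟩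
    · have h1 := (hf s).1
      refine ⟨h1.1, ⟨s.2.1.2.1.1.trans h1.2.1, h1.2.2⟩, ?_⟩
      rw [mem_ofPred_eq, not_requestedIn_neg_vadd_iff]
      intro x hx hxu
      have h2 := not_nextPoint_neg_vadd_le_iff.1 s.2.1.2.2 _ h1.1 h1.2.1
      by_contra! hlt
      exact hlt.not_ge ((hf s).2 ⟨hx, by linarith, hlt.le.trans h1.2.2⟩)
    · intro a b hab
      replace hab : f a = f b := congrArg Subtype.val hab
      rcases lt_trichotomy (a : ℝ) b with hlt | heq | hlt
      · have h1 := mem_lowerBounds.1 (hf a).2 b ⟨b.2.1.1, hlt, b.2.1.2.1.2⟩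
        have h2 := (hf b).1.2.1
        linarith
      · exact Subtype.ext heq
      · have h1 := mem_lowerBounds.1 (hf b).2 a ⟨a.2.1.1, hlt, a.2.1.2.1.2⟩
        have h2 := (hf a).1.2.1
        linarith
  · refine encard_le_one_iff.2 ?_
    rintro x y ⟨hx, hxe⟩ ⟨hy, hye⟩
    by_contra hne
    rcases lt_or_gt_of_ne hne with hlt | hlt
    · exact hxe.subset ⟨hy.1, hlt, hy.2.1.2⟩
    · exact hye.subset ⟨hx.1, hlt, hx.2.1.2⟩

/-- The mirror image: send a point to its predecessor; only the first point of the window has none.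
-/
theorem encard_isolated_left_le (S : PointConfig) (m u : ℝ) :
    S.count (Ioc 0 m ∩ {s | ¬ (-s +ᵥ S).RequestedIn u}) ≤
      S.count (Ioc 0 m ∩ {s | ¬ (-s +ᵥ S).nextPoint ≤ u}) + 1 := by
  set R := S.carrier ∩ (Ioc 0 m ∩ {s | ¬ (-s +ᵥ S).RequestedIn u})
  set R₁ := {s ∈ R | (S.carrier ∩ Ioo 0 s).Nonempty}
  set R₂ := {s ∈ R | S.carrier ∩ Ioo 0 s = ∅}
  have hR : R ⊆ R₁ ∪ R₂ := fun s hs =>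
    (S.carrier ∩ Ioo 0 s).eq_empty_or_nonempty.elim (fun h => .inr ⟨hs, h⟩) fun h => .inl ⟨hs, h⟩
  refine (encard_le_encard hR).trans ((encard_union_le _ _).trans (add_le_add ?_ ?_))
  · have h (s : R₁) : ∃ x, IsGreatest (S.carrier ∩ Ioo 0 s) x :=
      exists_isGreatest (Metric.isBounded_Ioo _ _) s.2.2
    choose f hf using h
    refine Function.Embedding.encard_le ⟨fun s => ⟨f s, ?_⟩, ?_⟩
    · have h1 := (hf s).1
      refine ⟨h1.1, ⟨h1.2.1, h1.2.2.le.trans s.2.1.2.1.2⟩, ?_⟩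
      rw [mem_ofPred_eq, not_nextPoint_neg_vadd_le_iff]
      intro x hx hxu
      have h2 := not_requestedIn_neg_vadd_iff.1 s.2.1.2.2 _ h1.1
      have h3 : f s < s - u := by
        by_contra! h4
        linarith [h2 h4, h1.2.2]
      by_contra! hlt
      by_cases hxs : x < s
      · exact hxu.not_ge ((hf s).2 ⟨hx, h1.2.1.trans hxu, hxs⟩)
      · linarith
    · intro a b hab
      replace hab : f a = f b := congrArg Subtype.val hab
      rcases lt_trichotomy (a : ℝ) b with hlt | heq | hlt
      · have h1 := mem_upperBounds.1 (hf b).2 a ⟨a.2.1.1, a.2.1.2.1.1, hlt⟩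
        have h2 := (hf a).1.2.2
        linarith
      · exact Subtype.ext heq
      · have h1 := mem_upperBounds.1 (hf a).2 b ⟨b.2.1.1, b.2.1.2.1.1, hlt⟩
        have h2 := (hf b).1.2.2
        linarith
  · refine encard_le_one_iff.2 ?_
    rintro x y ⟨hx, hxe⟩ ⟨hy, hye⟩
    by_contra hne
    rcases lt_or_gt_of_ne hne with hlt | hlt
    · exact hye.subset ⟨hx.1, hx.2.1.1, hlt⟩
    · exact hxe.subset ⟨hy.1, hy.2.1.1, hlt⟩

end PointConfig

section Palm

variable {P : Measure Ω} [IsProbabilityMeasure P] {ι : Type*} {X : ι → Ω → PointConfig} {i : ι}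

theorem one_sub_hitTTL (hX : IsStationaryPointProcess P (X i)) (t : ℝ) :
    1 - hitTTL P X t i =
      (palmProb P X i {c | c i ∈ {S : PointConfig | S.RequestedIn t}ᶜ}).toReal :=
  (hX.palmProb_compl (measurableSet_requestedIn t)).symm

/-- By stationarity $q(t)$ is also the probability of a point in $[-t-h,-h)$, an event contained in
that of a point in $[-t-h,0)$. -/
theorem requestProb_add_sub {X : Ω → PointConfig} (hX : IsStationaryPointProcess P X) {t h : ℝ}
    (hh : 0 ≤ h) :
    requestProb P X (t + h) - requestProb P X t =
      P.real {ω | X ω ∈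
        {S : PointConfig | S.RequestedIn (t + h : ℝ) ∧ ¬ (h +ᵥ S).RequestedIn t}} := by
  have hA := measurableSet_requestedIn t
  have h1 : requestProb P X t = P.real {ω | (h +ᵥ X ω).RequestedIn t} := by
    rw [requestProb, Measure.real, Measure.real]
    exact congrArg _ (hX.measure_vadd h hA).symm
  rw [h1, requestProb, ← measureReal_sdiff]
  · rfl
  · intro ω hω
    obtain ⟨x, hx, hx1, hx2⟩ := requestedIn_iff.1 hω
    exact requestedIn_iff.2 ⟨x - h, mem_vadd.1 hx, by linarith, by linarith⟩
  · exact ((measurable_vadd_const h).comp hX.measurable) hA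

theorem measurableSet_requestedIn_add (t h : ℝ) :
    MeasurableSet {S : PointConfig | S.RequestedIn (t + h : ℝ) ∧ ¬ (h +ᵥ S).RequestedIn t} :=
  (measurableSet_requestedIn (t + h)).inter
    (measurable_vadd_const h (measurableSet_requestedIn t)).compl

omit [IsProbabilityMeasure P] in
theorem lintegral_indicator_one_comp {X : Ω → PointConfig} (hX : Measurable X)
    {A : Set PointConfig} (hA : MeasurableSet A) :
    ∫⁻ ω, ((A.indicator 1 (X ω) : ℕ∞) : ℝ≥0∞) ∂P = P {ω | X ω ∈ A} := by
  rw [← lintegral_indicator_one (show MeasurableSet {ω | X ω ∈ A} from hX hA)]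
  refine lintegral_congr fun ω => ?_
  by_cases h : X ω ∈ A
  · rw [indicator_of_mem h, indicator_of_mem (show ω ∈ {ω | X ω ∈ A} from h)]
    simp
  · rw [indicator_of_notMem h, indicator_of_notMem (show ω ∉ {ω | X ω ∈ A} from h)]
    simp

/-- One half of $q'=\lambda(1-H)$: the left side is the mean number of points of $[-h,0)$ preceded
by a gap of length $t+h$. The next lemma is the other half, with look-back $t$. -/
theorem rate_mul_le_requestProb_sub (hX : IsStationaryPointProcess P (X i)) {t h : ℝ}
    (ht : 0 ≤ t) (hh : 0 ≤ h) :
    rate P (X i) * (1 - hitTTL P X (t + h) i) * h ≤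
      requestProb P (X i) (t + h) - requestProb P (X i) t := by
  have hA := (measurableSet_requestedIn (t + h)).compl
  have hp := hX.palmMeasure_toReal hA (neg_nonpos.2 hh)
  rw [zero_sub, neg_neg] at hp
  rw [requestProb_add_sub hX hh, one_sub_hitTTL hX, ← hp]
  refine ENNReal.toReal_mono (measure_ne_top _ _) ?_
  rw [palmMeasure_apply hX.measurable hA measurableSet_Ico,
    ← lintegral_indicator_one_comp hX.measurable (measurableSet_requestedIn_add t h)]
  exact lintegral_mono fun ω => ENat.toENNReal_mono (count_le_indicator (X i ω) ht)

theorem requestProb_sub_le_rate_mul (hX : IsStationaryPointProcess P (X i)) {t h : ℝ}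
    (hh : 0 ≤ h) :
    requestProb P (X i) (t + h) - requestProb P (X i) t ≤
      rate P (X i) * (1 - hitTTL P X t i) * h := by
  have hA := (measurableSet_requestedIn t).compl
  have hp := hX.palmMeasure_toReal hA (neg_nonpos.2 hh)
  rw [zero_sub, neg_neg] at hp
  rw [requestProb_add_sub hX hh, one_sub_hitTTL hX, ← hp]
  refine ENNReal.toReal_mono ?_ ?_
  · rw [hX.palmMeasure_eq hA]
    exact ENNReal.mul_ne_top ((palmMeasure_le hX.measurable hA).trans_lt
      hX.intensity_ne_top.lt_top).ne (by simp)
  rw [palmMeasure_apply hX.measurable hA measurableSet_Ico,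
    ← lintegral_indicator_one_comp hX.measurable (measurableSet_requestedIn_add t h)]
  exact lintegral_mono fun ω => ENat.toENNReal_mono (indicator_le_count (X i ω) t h)

/-- Both means over $(0,m]$ grow linearly in $m$, so the additive error $1$ disappears after
division by $m\to\infty$. -/
theorem palmMeasure_le_of_count_le {X : Ω → PointConfig} (hX : IsStationaryPointProcess P X)
    {A B : Set PointConfig} (hA : MeasurableSet A) (hB : MeasurableSet B)
    (h : ∀ (S : PointConfig) (m : ℝ), S.count (Ioc 0 m ∩ {s | -s +ᵥ S ∈ A}) ≤
      S.count (Ioc 0 m ∩ {s | -s +ᵥ S ∈ B}) + 1) :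
    palmMeasure P X A (Ioc 0 1) ≤ palmMeasure P X B (Ioc 0 1) := by
  have hA' := ((palmMeasure_le hX.measurable hA).trans_lt hX.intensity_ne_top.lt_top).ne
  have hB' := ((palmMeasure_le hX.measurable hB).trans_lt hX.intensity_ne_top.lt_top).ne
  have key (m : ℕ) : palmMeasure P X A (Ioc 0 1) * m ≤ palmMeasure P X B (Ioc 0 1) * m + 1 := by
    have h1 := hX.palmMeasure_eq hA (Ioc 0 m)
    have h2 := hX.palmMeasure_eq hB (Ioc 0 m)
    rw [Real.volume_Ioc, sub_zero, ENNReal.ofReal_natCast] at h1 h2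
    rw [← h1, ← h2, palmMeasure_apply hX.measurable hA measurableSet_Ioc,
      palmMeasure_apply hX.measurable hB measurableSet_Ioc]
    calc _ ≤ ∫⁻ ω, (((X ω).count (Ioc 0 (m : ℝ) ∩ {s | -s +ᵥ X ω ∈ B}) : ℝ≥0∞) + 1) ∂P := by
          refine lintegral_mono fun ω => ?_
          simpa using ENat.toENNReal_mono (h (X ω) m)
      _ = _ := by
          rw [lintegral_add_right _ measurable_const]
          simp
  by_contra! hlt
  rw [← ENNReal.toReal_lt_toReal hB' hA'] at hlt
  obtain ⟨m, hm⟩ := exists_nat_gt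
    (1 / ((palmMeasure P X A (Ioc 0 1)).toReal - (palmMeasure P X B (Ioc 0 1)).toReal))
  rw [div_lt_iff₀ (sub_pos.2 hlt)] at hm
  have h3 := ENNReal.toReal_mono (by finiteness) (key m)
  rw [ENNReal.toReal_add (by finiteness) (by simp), ENNReal.toReal_mul, ENNReal.toReal_mul,
    ENNReal.toReal_natCast, ENNReal.toReal_one] at h3
  linarith

/-- Under the Palm probability the gaps before and after the origin have the same law, since gaps to
the left and to the right can be matched up to one point per window. -/
theorem hitTTL_eq_interCdf (hX : IsStationaryPointProcess P (X i)) (t : ℝ) :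
    hitTTL P X t i = interCdf P X i t := by
  have hA := measurableSet_requestedIn t
  have hB := measurableSet_nextPoint_le t
  rw [← sub_right_inj (a := (1 : ℝ)), one_sub_hitTTL hX,
    show 1 - interCdf P X i t = _ from (hX.palmProb_compl hB).symm,
    palmProb_coord hX.measurable hA.compl, palmProb_coord hX.measurable hB.compl]
  congr 2
  exact le_antisymm
    (palmMeasure_le_of_count_le hX hA.compl hB.compl fun S m => S.encard_isolated_left_le m t)
    (palmMeasure_le_of_count_le hX hB.compl hA.compl fun S m => S.encard_isolated_right_le m t)

end Palm

/-! ### Chernoff bounds for sums of independent indicators. -/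

section Chernoff

variable {P : Measure Ω} [IsProbabilityMeasure P] {ι E : Type*} [MeasurableSpace E]
  {Y : ι → Ω → E} {A : Set E}

theorem mgf_indicator_le {Y : Ω → E} (hY : Measurable Y) (hA : MeasurableSet A) (t : ℝ) :
    mgf (fun ω => A.indicator (1 : E → ℝ) (Y ω)) P t ≤
      Real.exp ((Real.exp t - 1) * P.real {ω | Y ω ∈ A}) := by
  have hm : MeasurableSet {ω | Y ω ∈ A} := hY hA
  have h (ω : Ω) : Real.exp (t * A.indicator 1 (Y ω)) =
      1 + (Real.exp t - 1) * {ω | Y ω ∈ A}.indicator 1 ω := by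
    by_cases hω : Y ω ∈ A
    · rw [indicator_of_mem hω, indicator_of_mem (show ω ∈ {ω | Y ω ∈ A} from hω)]
      simp
    · rw [indicator_of_notMem hω, indicator_of_notMem (show ω ∉ {ω | Y ω ∈ A} from hω)]
      simp
  have hi : Integrable ({ω | Y ω ∈ A}.indicator (1 : Ω → ℝ)) P :=
    (integrable_const 1).indicator hm
  rw [mgf]
  simp_rw [h]
  rw [integral_add (integrable_const _) (hi.const_mul _), integral_const_mul,
    integral_indicator_one hm, integral_const, probReal_univ, one_smul, add_comm]
  exact Real.add_one_le_exp _

theorem mgf_sum_indicator_le (hY : ∀ j, Measurable (Y j)) (hind : iIndepFun Y P)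
    (hA : MeasurableSet A) (s : Finset ι) (t : ℝ) :
    mgf (fun ω => ∑ j ∈ s, A.indicator (1 : E → ℝ) (Y j ω)) P t ≤
      Real.exp ((Real.exp t - 1) * ∑ j ∈ s, P.real {ω | Y j ω ∈ A}) := by
  have hf : Measurable (A.indicator (1 : E → ℝ)) := measurable_one.indicator hA
  have h := (hind.comp (fun _ => A.indicator (1 : E → ℝ)) fun _ => hf).mgf_sum (t := t)
    (fun j => hf.comp (hY j)) s
  have hs : (∑ j ∈ s, A.indicator (1 : E → ℝ) ∘ Y j) =
      fun ω => ∑ j ∈ s, A.indicator (1 : E → ℝ) (Y j ω) := by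
    ext ω
    simp
  rw [hs] at h
  rw [h, Finset.mul_sum, Real.exp_sum]
  exact Finset.prod_le_prod (fun j _ => mgf_nonneg) fun j _ => mgf_indicator_le (hY j) hA t

theorem integrable_exp_mul_sum_indicator (hY : ∀ j, Measurable (Y j)) (hA : MeasurableSet A)
    (s : Finset ι) (t : ℝ) :
    Integrable (fun ω => Real.exp (t * ∑ j ∈ s, A.indicator (1 : E → ℝ) (Y j ω))) P := by
  have hf : Measurable (A.indicator (1 : E → ℝ)) := measurable_one.indicator hA
  refine integrable_exp_mul_of_mem_Icc (a := 0) (b := s.card)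
    (Finset.measurable_fun_sum s fun j _ => hf.comp (hY j)).aemeasurable
    (ae_of_all _ fun ω => ⟨Finset.sum_nonneg fun j _ => indicator_nonneg (by simp) _, ?_⟩)
  rw [← nsmul_one s.card]
  exact Finset.sum_le_card_nsmul _ _ _ fun j _ => indicator_apply_le' (by simp) (by simp)

theorem measure_sum_indicator_ge_le (hY : ∀ j, Measurable (Y j)) (hind : iIndepFun Y P)
    (hA : MeasurableSet A) (s : Finset ι) {C d : ℝ} (hd : 1 ≤ d) (hdC : d ≤ C)
    (hμ : ∑ j ∈ s, P.real {ω | Y j ω ∈ A} ≤ C - 2 * d) :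
    P.real {ω | C - 1 ≤ ∑ j ∈ s, A.indicator (1 : E → ℝ) (Y j ω)} ≤
      Real.exp (-(d ^ 2 / (8 * C))) := by
  have hC : 0 < C := by linarith
  set μ := ∑ j ∈ s, P.real {ω | Y j ω ∈ A}
  have hμ0 : 0 ≤ μ := Finset.sum_nonneg fun _ _ => measureReal_nonneg
  -- With this $t$ the quadratic term is $t^2C=td/4$. The threshold $C-1$ leaves room for one
  -- dropped content and costs $t\le td$, so the exponent $t-2td+td/4$ is still below
  -- $-td/2=-d^2/(8C)$.
  set t := d / (4 * C) with ht
  have htC : t * C = d / 4 := by rw [ht]; field_simp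
  have ht0 : 0 < t := by positivity
  have ht1 : t ≤ 1 := by rw [ht, div_le_one (by positivity)]; linarith
  have hexp : Real.exp t - 1 ≤ t + t ^ 2 := by
    have := (abs_le.1 (Real.abs_exp_sub_one_sub_id_le (abs_le.2 ⟨by linarith, ht1⟩))).2
    linarith
  have hdiv : d ^ 2 / (8 * C) = t * d / 2 := by rw [ht]; field_simp; norm_num
  refine (measure_ge_le_exp_mul_mgf _ ht0.le
    (integrable_exp_mul_sum_indicator hY hA s t)).trans ?_
  refine (mul_le_mul_of_nonneg_left (mgf_sum_indicator_le hY hind hA s t)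
    (Real.exp_nonneg _)).trans ?_
  rw [← Real.exp_add, Real.exp_le_exp, hdiv]
  have h1 : (Real.exp t - 1) * μ ≤ (t + t ^ 2) * (C - 2 * d) :=
    mul_le_mul hexp hμ hμ0 (by positivity)
  have h2 : t ^ 2 * C = t * d / 4 := by rw [pow_two, mul_assoc, htC]; ring
  nlinarith [mul_nonneg ht0.le (sub_nonneg.2 hd), mul_nonneg (sq_nonneg t) (zero_le_one.trans hd),
    mul_nonneg ht0.le (zero_le_one.trans hd)]

theorem measure_sum_indicator_le_le (hY : ∀ j, Measurable (Y j)) (hind : iIndepFun Y P)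
    (hA : MeasurableSet A) (s : Finset ι) {C d : ℝ} (hd : 0 < d) (hdC : d ≤ C)
    (hμ : C + d ≤ ∑ j ∈ s, P.real {ω | Y j ω ∈ A}) :
    P.real {ω | ∑ j ∈ s, A.indicator (1 : E → ℝ) (Y j ω) ≤ C} ≤
      Real.exp (-(d ^ 2 / (8 * C))) := by
  have hC : 0 < C := by linarith
  set μ := ∑ j ∈ s, P.real {ω | Y j ω ∈ A}
  set t := d / (4 * C) with ht
  have htC : t * C = d / 4 := by rw [ht]; field_simp
  have ht0 : 0 < t := by positivity
  have ht1 : t ≤ 1 := by rw [ht, div_le_one (by positivity)]; linarith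
  have hexp : Real.exp (-t) - 1 ≤ -(t - t ^ 2) := by
    have := (abs_le.1 (Real.abs_exp_sub_one_sub_id_le (x := -t)
      (abs_le.2 ⟨by linarith, by linarith⟩))).2
    linarith [neg_sq t]
  have hdiv : d ^ 2 / (8 * C) = t * d / 2 := by rw [ht]; field_simp; norm_num
  refine (measure_le_le_exp_mul_mgf _ (neg_nonpos.2 ht0.le)
    (integrable_exp_mul_sum_indicator hY hA s (-t))).trans ?_
  refine (mul_le_mul_of_nonneg_left (mgf_sum_indicator_le hY hind hA s (-t))
    (Real.exp_nonneg _)).trans ?_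
  rw [← Real.exp_add, Real.exp_le_exp, hdiv, neg_neg]
  have h1 : (Real.exp (-t) - 1) * μ ≤ -(t - t ^ 2) * (C + d) := by
    refine (mul_le_mul_of_nonneg_right hexp (by linarith)).trans ?_
    exact mul_le_mul_of_nonpos_left hμ (by nlinarith)
  have h2 : t ^ 2 * C = t * d / 4 := by rw [pow_two, mul_assoc, htC]; ring
  have h3 : t ^ 2 * d ≤ t ^ 2 * C := mul_le_mul_of_nonneg_left hdC (sq_nonneg t)
  -- The exponent is at most $-td+t^2(C+d)$, and $t^2(C+d)\le td/2$ because $d\le C$.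
  nlinarith

end Chernoff

/-! ### Palm probabilities of events about the other contents. -/

section Palm

variable {P : Measure Ω} [IsProbabilityMeasure P] {ι : Type*} {X : ι → Ω → PointConfig} {i : ι}

theorem measurable_indicator_vadd {Ω : Type*} [MeasurableSpace Ω] {X : ι → Ω → PointConfig}
    (hX : ∀ j, Measurable (X j)) {D : Set (ι → PointConfig)} (hD : MeasurableSet D) :
    Measurable fun q : Ω × ℝ =>
      D.indicator (1 : (ι → PointConfig) → ℝ≥0∞) fun j => -q.2 +ᵥ X j q.1 := by
  refine (measurable_one.indicator hD).comp (measurable_pi_lambda _ fun j => ?_)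
  exact PointConfig.measurable_vadd.comp (measurable_snd.neg.prodMk ((hX j).comp measurable_fst))

theorem measurable_setLIntegral_points {Ω : Type*} [MeasurableSpace Ω] {X : Ω → PointConfig}
    (hX : Measurable X) {f : Ω × ℝ → ℝ≥0∞} (hf : Measurable f) :
    Measurable fun ω => ∫⁻ s in Ioc (0 : ℝ) 1, f (ω, s) ∂(X ω).points := by
  simp_rw [← lintegral_indicator measurableSet_Ioc]
  let κ : Kernel Ω ℝ := pointKernel.comap X hX
  refine Measurable.lintegral_kernel_prod_right (κ := κ)
    (f := fun ω s => (Ioc (0 : ℝ) 1).indicator (fun s => f (ω, s)) s) ?_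
  exact hf.indicator (measurable_snd measurableSet_Ioc)

omit [IsProbabilityMeasure P] in
theorem palmProb_eq_lintegral (A : Set (ι → PointConfig)) :
    palmProb P X i A = (intensity P (X i))⁻¹ * ∫⁻ ω, ∫⁻ s in Ioc (0 : ℝ) 1,
      A.indicator 1 (fun j => -s +ᵥ X j ω) ∂(X i ω).points ∂P := by
  simp_rw [setLIntegral_points _ measurableSet_Ioc]
  rfl

-- Measurability of one summand suffices for additivity of the integral. The sets $A$ and $B$ may
-- thus involve `fillTime`, whose measurability is never established.
omit [IsProbabilityMeasure P] in
theorem palmProb_le_add (hX : ∀ j, Measurable (X j)) {A B D : Set (ι → PointConfig)}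
    (hD : MeasurableSet D) (h : A ⊆ B ∪ D) :
    palmProb P X i A ≤ palmProb P X i B + palmProb P X i D := by
  simp_rw [palmProb_eq_lintegral]
  have hm := measurable_indicator_vadd hX hD
  rw [← mul_add, ← lintegral_add_right _ (measurable_setLIntegral_points (hX i) hm)]
  gcongr with ω
  have hω : Measurable fun s : ℝ =>
      D.indicator (1 : (ι → PointConfig) → ℝ≥0∞) fun j => -s +ᵥ X j ω :=
    hm.comp measurable_prodMk_left
  rw [← lintegral_add_right _ hω]
  gcongr with s
  refine indicator_apply_le' (fun hA => ?_) fun _ => zero_le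
  rcases h hA with h | h
  · rw [indicator_of_mem h]
    exact le_self_add
  · rw [indicator_of_mem h]
    exact le_add_self

/-- Condition on $X_i$, which is independent of the rest: each of its points $s$ contributes the
probability that the others, shifted by $-s$, lie in $D$, hence at most $\varepsilon$. Summing over
$(0,1]$ gives intensity times $\varepsilon$. -/
theorem palmProb_le_of_forall_measure_le [Fintype ι] [DecidableEq ι]
    (hX : ∀ j, Measurable (X j)) (hind : iIndepFun X P) (h0 : intensity P (X i) ≠ 0)
    (htop : intensity P (X i) ≠ ⊤) {D : Set (↥(Finset.univ.erase i) → PointConfig)}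
    (hD : MeasurableSet D) {ε : ℝ≥0∞}
    (hε : ∀ s : ℝ, P {ω | (fun j : ↥(Finset.univ.erase i) => s +ᵥ X j ω) ∈ D} ≤ ε) :
    palmProb P X i {c | (fun j : ↥(Finset.univ.erase i) => c j) ∈ D} ≤ ε := by
  set R : Ω → ↥(Finset.univ.erase i) → PointConfig := fun ω j => X j ω
  have hR : Measurable R := measurable_pi_lambda _ fun j => hX j
  have hXR : IndepFun (X i) R P := by
    have := hind.indepFun_finset {i} (Finset.univ.erase i) (by simp) hX
    exact this.comp (φ := fun c : ↥({i} : Finset ι) → PointConfig =>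
      c ⟨i, Finset.mem_singleton_self i⟩) (measurable_pi_apply _) measurable_id
  have hmap := (indepFun_iff_map_prod_eq_prod_map_map (hX i).aemeasurable hR.aemeasurable).1 hXR
  have hm1 : Measurable fun q : (PointConfig × (↥(Finset.univ.erase i) → PointConfig)) × ℝ =>
      D.indicator (1 : (↥(Finset.univ.erase i) → PointConfig) → ℝ≥0∞) fun j => -q.2 +ᵥ q.1.2 j :=
    measurable_indicator_vadd (X := fun j (q : PointConfig ×
      (↥(Finset.univ.erase i) → PointConfig)) => q.2 j)
      (fun j => (measurable_pi_apply j).comp measurable_snd) hD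
  have hm := measurable_setLIntegral_points measurable_fst hm1
  have hprob : IsProbabilityMeasure (P.map R) := Measure.isProbabilityMeasure_map hR.aemeasurable
  have hprob' : IsProbabilityMeasure (P.map (X i)) :=
    Measure.isProbabilityMeasure_map (hX i).aemeasurable
  have key : ∫⁻ ω, ∫⁻ s in Ioc (0 : ℝ) 1, D.indicator 1 (fun j => -s +ᵥ R ω j)
      ∂(X i ω).points ∂P ≤ intensity P (X i) * ε := by
    calc _ = ∫⁻ q, ∫⁻ s in Ioc (0 : ℝ) 1, D.indicator 1 (fun j => -s +ᵥ q.2 j) ∂q.1.points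
            ∂(P.map fun ω => (X i ω, R ω)) :=
          (lintegral_map hm ((hX i).prodMk hR)).symm
      _ = ∫⁻ c, ∫⁻ r, ∫⁻ s in Ioc (0 : ℝ) 1, D.indicator 1 (fun j => -s +ᵥ r j) ∂c.points
            ∂(P.map R) ∂(P.map (X i)) := by
          rw [hmap, lintegral_prod _ hm.aemeasurable]
      _ ≤ ∫⁻ c, (c.count (Ioc 0 1) : ℝ≥0∞) * ε ∂(P.map (X i)) := by
          refine lintegral_mono fun c => ?_
          have hm2 : Measurable fun q : (↥(Finset.univ.erase i) → PointConfig) × ℝ =>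
              D.indicator (1 : (↥(Finset.univ.erase i) → PointConfig) → ℝ≥0∞) fun j => -q.2 +ᵥ q.1 j :=
            measurable_indicator_vadd (X := fun j (q : ↥(Finset.univ.erase i) → PointConfig) =>
              q j) measurable_pi_apply hD
          rw [lintegral_lintegral_swap hm2.aemeasurable]
          calc _ ≤ ∫⁻ s in Ioc (0 : ℝ) 1, ε ∂c.points := by
                refine lintegral_mono fun s => ?_
                have hs : MeasurableSet {r : ↥(Finset.univ.erase i) → PointConfig |
                    (fun j => -s +ᵥ r j) ∈ D} :=
                  (measurable_pi_lambda _ fun j =>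
                    (measurable_vadd_const (-s)).comp (measurable_pi_apply j)) hD
                refine le_trans (Eq.le ?_) (hε (-s))
                refine Eq.trans ?_ (Measure.map_apply hR hs)
                rw [← lintegral_indicator_one hs]
                rfl
            _ = _ := by
                rw [setLIntegral_const, points_apply _ measurableSet_Ioc, mul_comm]
      _ = _ := by
          rw [lintegral_mul_const _ (measurable_count measurableSet_Ioc),
            lintegral_map (measurable_count measurableSet_Ioc) (hX i), intensity]
  rw [palmProb_eq_lintegral]
  calc _ ≤ (intensity P (X i))⁻¹ * (intensity P (X i) * ε) := by
        gcongr
        exact key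
    _ = ε := by rw [← mul_assoc, ENNReal.inv_mul_cancel h0 htop, one_mul]

end Palm

/-! ### Comparison of the LRU cache with TTL caches. -/

section Caches

variable {P : Measure Ω} [IsProbabilityMeasure P] {ι : Type*} [Fintype ι]
  {X : ι → Ω → PointConfig}

theorem distinctCount_eq_sum (c : ι → PointConfig) (t : EReal) :
    (distinctCount c t : ℝ) =
      ∑ j, {S : PointConfig | S.RequestedIn t}.indicator (1 : PointConfig → ℝ) (c j) := by
  classical
  rw [distinctCount, Set.ncard_eq_toFinset_card', Finset.card_eq_sum_ones, Nat.cast_sum]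
  simp [indicator_apply]

theorem distinctCount_mono (c : ι → PointConfig) {s t : EReal} (hst : s ≤ t) :
    distinctCount c s ≤ distinctCount c t :=
  ncard_le_ncard (fun _ h => RequestedIn.mono hst h) (toFinite _)

theorem expectedDistinct_eq_sum (hX : ∀ j, Measurable (X j)) (t : ℝ) :
    expectedDistinct P X t = ∑ j, requestProb P (X j) t := by
  have hm (j : ι) : MeasurableSet {ω | X j ω ∈ {S : PointConfig | S.RequestedIn t}} :=
    hX j (measurableSet_requestedIn t)
  rw [expectedDistinct]
  simp_rw [distinctCount_eq_sum]
  have h (j : ι) (ω : Ω) : {S : PointConfig | S.RequestedIn t}.indicator (1 : PointConfig → ℝ)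
      (X j ω) = {ω | X j ω ∈ {S : PointConfig | S.RequestedIn t}}.indicator 1 ω := rfl
  simp_rw [h]
  rw [integral_finsetSum _ fun j _ => (integrable_const 1).indicator (hm j)]
  refine Finset.sum_congr rfl fun j _ => ?_
  rw [integral_indicator_one (hm j)]
  rfl

omit [IsProbabilityMeasure P] in
theorem requestProb_nonneg (Y : Ω → PointConfig) (t : ℝ) : 0 ≤ requestProb P Y t :=
  measureReal_nonneg

theorem requestProb_le_one (Y : Ω → PointConfig) (t : ℝ) : requestProb P Y t ≤ 1 :=
  measureReal_le_one

omit [Fintype ι] in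
theorem hitTTL_mem_Icc {i : ι} (hX : IsStationaryPointProcess P (X i)) (t : ℝ) :
    hitTTL P X t i ∈ Icc 0 1 := by
  refine ⟨ENNReal.toReal_nonneg, ?_⟩
  rw [← sub_nonneg, one_sub_hitTTL hX]
  exact ENNReal.toReal_nonneg

variable [DecidableEq ι]

theorem palmProb_sum_indicator_mem_le (hX : ∀ j, IsStationaryPointProcess P (X j))
    (hind : iIndepFun X P) (i : ι) {A : Set PointConfig} (hA : MeasurableSet A) {U : Set ℝ}
    (hU : MeasurableSet U) {ε : ℝ}
    (hε : ∀ s : ℝ, P.real {ω | ∑ j ∈ Finset.univ.erase i,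
      A.indicator (1 : PointConfig → ℝ) (s +ᵥ X j ω) ∈ U} ≤ ε) :
    palmProb P X i {c | ∑ j ∈ Finset.univ.erase i,
      A.indicator (1 : PointConfig → ℝ) (c j) ∈ U} ≤ ENNReal.ofReal ε := by
  have hD : MeasurableSet {r : ↥(Finset.univ.erase i) → PointConfig |
      ∑ j, A.indicator (1 : PointConfig → ℝ) (r j) ∈ U} :=
    (Finset.measurable_fun_sum _ fun j _ =>
      (measurable_one.indicator hA).comp (measurable_pi_apply j)) hU
  have h := palmProb_le_of_forall_measure_le (fun j => (hX j).measurable) hind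
    (hX i).intensity_ne_zero (hX i).intensity_ne_top hD (ε := ENNReal.ofReal ε) ?_
  · convert h using 2
    ext c
    change _ ↔ ∑ j : ↥(Finset.univ.erase i), A.indicator (1 : PointConfig → ℝ) (c j) ∈ U
    rw [Finset.sum_coe_sort _ fun j => A.indicator (1 : PointConfig → ℝ) (c j)]
    rfl
  · intro s
    rw [← ENNReal.ofReal_toReal (measure_ne_top P _)]
    refine ENNReal.ofReal_le_ofReal ((Eq.le ?_).trans (hε s))
    rw [Measure.real]
    congr 3
    ext ω
    change ∑ j : ↥(Finset.univ.erase i), A.indicator (1 : PointConfig → ℝ) (s +ᵥ X j ω) ∈ U ↔ _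
    rw [Finset.sum_coe_sort _ fun j => A.indicator (1 : PointConfig → ℝ) (s +ᵥ X j ω)]

omit [DecidableEq ι] [Fintype ι] [IsProbabilityMeasure P] in
theorem sum_measure_vadd_mem (hX : ∀ j, IsStationaryPointProcess P (X j)) (s : Finset ι)
    (t u : ℝ) :
    ∑ j ∈ s, P.real {ω | u +ᵥ X j ω ∈ {S : PointConfig | S.RequestedIn t}} =
      ∑ j ∈ s, requestProb P (X j) t :=
  Finset.sum_congr rfl fun j _ =>
    congrArg ENNReal.toReal ((hX j).measure_vadd u (measurableSet_requestedIn t))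

omit [DecidableEq ι] [Fintype ι] in
theorem palmProb_univ {i : ι} (hX : IsStationaryPointProcess P (X i)) :
    palmProb P X i univ = 1 := by
  have h := palmProb_coord (P := P) (X := X) (i := i) hX.measurable MeasurableSet.univ
  have h2 : palmMeasure P (X i) univ (Ioc 0 1) = intensity P (X i) := by
    rw [palmMeasure_apply hX.measurable MeasurableSet.univ measurableSet_Ioc, intensity]
    simp
  rw [h2, ENNReal.inv_mul_cancel hX.intensity_ne_zero hX.intensity_ne_top] at h
  exact h

omit [DecidableEq ι] [Fintype ι] [IsProbabilityMeasure P] in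
theorem palmProb_mono {i : ι} {A B : Set (ι → PointConfig)} (h : A ⊆ B) :
    palmProb P X i A ≤ palmProb P X i B := by
  rw [palmProb_eq_lintegral, palmProb_eq_lintegral]
  gcongr with ω s

/-- If the expected number of distinct requested contents is below the cache size at time `t`, by a
margin `2d`, then the TTL cache with timer `t` cannot do much better than the LRU cache. -/
theorem hitTTL_sub_le_hitLRU (hX : ∀ j, IsStationaryPointProcess P (X j)) (hind : iIndepFun X P)
    {C d t : ℝ} (hd : 1 ≤ d) (hdC : d ≤ C)
    (hK : expectedDistinct P X t ≤ C - 2 * d) (i : ι) :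
    hitTTL P X t i - Real.exp (-(d ^ 2 / (8 * C))) ≤ hitLRU P X C i := by
  set A := {S : PointConfig | S.RequestedIn t}
  have hA : MeasurableSet A := measurableSet_requestedIn t
  have hf : Measurable (A.indicator (1 : PointConfig → ℝ)) := measurable_one.indicator hA
  set D := {c : ι → PointConfig | ∑ j ∈ Finset.univ.erase i,
    A.indicator (1 : PointConfig → ℝ) (c j) ∈ Ici (C - 1)}
  have hDm : MeasurableSet D :=
    (Finset.measurable_fun_sum _ fun j _ => hf.comp (measurable_pi_apply j)) measurableSet_Ici
  have hsub : {c : ι → PointConfig | (c i).RequestedIn t} ⊆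
      {c | (c i).RequestedIn (fillTime C c)} ∪ D := by
    intro c hc
    -- If $\tau<t$, then already $Y(t)\ge C$, and the contents other than $i$ account for at least
    -- $C-1$ of it.
    by_cases h : (t : EReal) ≤ fillTime C c
    · exact .inl (RequestedIn.mono h hc)
    · rw [not_le, fillTime, iInf_lt_iff] at h
      obtain ⟨u, hu⟩ := h
      rw [iInf_lt_iff] at hu
      obtain ⟨hu, hut⟩ := hu
      have h1 : C ≤ distinctCount c t :=
        le_trans hu (by exact_mod_cast distinctCount_mono c hut.le)
      rw [distinctCount_eq_sum, ← Finset.add_sum_erase _ _ (Finset.mem_univ i)] at h1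
      have h2 : A.indicator (1 : PointConfig → ℝ) (c i) ≤ 1 :=
        indicator_apply_le' (by simp) (by simp)
      refine .inr ?_
      change C - 1 ≤ _
      linarith
  have hD := palmProb_sum_indicator_mem_le hX hind i hA (measurableSet_Ici (a := C - 1))
    (ε := Real.exp (-(d ^ 2 / (8 * C)))) fun s => by
      refine measure_sum_indicator_ge_le (Y := fun j ω => s +ᵥ X j ω)
        (fun j => (measurable_vadd_const s).comp (hX j).measurable)
        (hind.comp (fun _ S => s +ᵥ S) fun _ => measurable_vadd_const s) hA _ hd hdC ?_
      rw [sum_measure_vadd_mem hX]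
      refine le_trans (Finset.sum_le_sum_of_subset_of_nonneg (Finset.erase_subset _ _)
        fun j _ _ => requestProb_nonneg _ _) ?_
      rwa [← expectedDistinct_eq_sum fun j => (hX j).measurable]
  have h := (palmProb_le_add (P := P) (i := i) (fun j => (hX j).measurable) hDm hsub).trans
    (add_le_add_right hD _)
  -- Finiteness comes from monotonicity, since the LRU event is not known to be measurable.
  have hfin : palmProb P X i {c | (c i).RequestedIn (fillTime C c)} ≠ ⊤ :=
    ((palmProb_mono (subset_univ _)).trans (palmProb_univ (hX i)).le).trans_lt
      ENNReal.one_lt_top |>.ne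
  have h' := ENNReal.toReal_mono (ENNReal.add_ne_top.2 ⟨hfin, ENNReal.ofReal_ne_top⟩) h
  rw [ENNReal.toReal_add hfin ENNReal.ofReal_ne_top, ENNReal.toReal_ofReal (Real.exp_nonneg _)]
    at h'
  rw [sub_le_iff_le_add]
  exact h'

/-- If the expected number of distinct requested contents is above the cache size at time `t`, by a
margin `2d`, then the LRU cache cannot do much better than the TTL cache with timer `t`. -/
theorem hitLRU_le_hitTTL_add (hX : ∀ j, IsStationaryPointProcess P (X j)) (hind : iIndepFun X P)
    {C d t : ℝ} (hd : 1 ≤ d) (hdC : d ≤ C)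
    (hK : C + 2 * d ≤ expectedDistinct P X t) (i : ι) :
    hitLRU P X C i ≤ hitTTL P X t i + Real.exp (-(d ^ 2 / (8 * C))) := by
  set A := {S : PointConfig | S.RequestedIn t}
  have hA : MeasurableSet A := measurableSet_requestedIn t
  have hf : Measurable (A.indicator (1 : PointConfig → ℝ)) := measurable_one.indicator hA
  set D := {c : ι → PointConfig | ∑ j ∈ Finset.univ.erase i,
    A.indicator (1 : PointConfig → ℝ) (c j) ∈ Iic C}
  have hDm : MeasurableSet D :=
    (Finset.measurable_fun_sum _ fun j _ => hf.comp (measurable_pi_apply j)) measurableSet_Iic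
  have hsub : {c | (c i).RequestedIn (fillTime C c)} ⊆
      {c : ι → PointConfig | (c i).RequestedIn t} ∪ D := by
    intro c hc
    by_cases h : fillTime C c ≤ t
    · exact .inl (RequestedIn.mono h hc)
    · have h1 : (distinctCount c t : ℝ) < C := by
        by_contra! h1
        exact h (iInf₂_le t h1)
      rw [distinctCount_eq_sum, ← Finset.add_sum_erase _ _ (Finset.mem_univ i)] at h1
      have h2 : 0 ≤ A.indicator (1 : PointConfig → ℝ) (c i) := indicator_nonneg (by simp) _
      refine .inr ?_
      change _ ≤ C
      linarith
  have hD := palmProb_sum_indicator_mem_le hX hind i hA (measurableSet_Iic (a := C))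
    (ε := Real.exp (-(d ^ 2 / (8 * C)))) fun s => by
      refine measure_sum_indicator_le_le (Y := fun j ω => s +ᵥ X j ω)
        (fun j => (measurable_vadd_const s).comp (hX j).measurable)
        (hind.comp (fun _ S => s +ᵥ S) fun _ => measurable_vadd_const s) hA _
        (zero_lt_one.trans_le hd) hdC ?_
      rw [sum_measure_vadd_mem hX]
      rw [expectedDistinct_eq_sum fun j => (hX j).measurable,
        ← Finset.add_sum_erase _ _ (Finset.mem_univ i)] at hK
      -- Dropping content $i$ costs at most $1\le d$ of the margin $2d$, which leaves the margin $d$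
      -- of the Chernoff bound.
      linarith [requestProb_le_one (P := P) (X i) t]
  have h := (palmProb_le_add (P := P) (i := i) (fun j => (hX j).measurable) hDm hsub).trans
    (add_le_add_right hD _)
  have hfin := (hX i).palmProb_ne_top hA
  have h' := ENNReal.toReal_mono (ENNReal.add_ne_top.2 ⟨hfin, ENNReal.ofReal_ne_top⟩) h
  rw [ENNReal.toReal_add hfin ENNReal.ofReal_ne_top, ENNReal.toReal_ofReal (Real.exp_nonneg _)]
    at h'
  exact h'

end Caches

/-! ### Tail sums of popularities. -/

theorem tailSum_eq_sum_symm {n : ℕ} (p : Fin n → ℝ) (k : ℕ) :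
    tailSum p k = ∑ i, if k ≤ ((Tuple.sort fun i => -p i).symm i : ℕ) then p i else 0 := by
  rw [tailSum, ← Equiv.sum_comp (Tuple.sort fun i => -p i) fun i =>
    if k ≤ ((Tuple.sort fun i => -p i).symm i : ℕ) then p i else 0]
  simp_rw [Equiv.symm_apply_apply]

/-- An entry of rank at least $k$ (counted from $0$) with value at least $\theta$ would force all
earlier ranks above $\theta$ too, which makes at least $k+1$ such entries. -/
theorem tailSum_le_sum_lt {n : ℕ} {p : Fin n → ℝ} (hp : ∀ i, 0 ≤ p i) {k : ℕ} {θ : ℝ}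
    (hk : (Finset.univ.filter fun i => θ ≤ p i).card ≤ k) :
    tailSum p k ≤ ∑ i with p i < θ, p i := by
  rw [tailSum_eq_sum_symm, Finset.sum_filter]
  refine Finset.sum_le_sum fun i _ => ?_
  set σ := Tuple.sort fun i => -p i
  by_cases hi : k ≤ (σ.symm i : ℕ)
  · rw [if_pos hi, if_pos]
    by_contra! hθ
    have hsub : (Finset.Iic (σ.symm i)).map σ.toEmbedding ⊆
        Finset.univ.filter fun i => θ ≤ p i := by
      intro j hj
      obtain ⟨l, hl, rfl⟩ := Finset.mem_map.1 hj
      have h := Tuple.monotone_sort (fun i => -p i) (Finset.mem_Iic.1 hl)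
      simp only [Function.comp_apply, neg_le_neg_iff] at h
      rw [Equiv.apply_symm_apply] at h
      simpa using hθ.trans h
    have h := Finset.card_le_card hsub
    rw [Finset.card_map, Fin.card_Iic] at h
    omega
  · rw [if_neg hi]
    split_ifs <;> simp [hp]

/-- Bound $q_i$ by $1$ on the $k$ largest entries of $p$ and by $a\,p_i$ on the others. -/
theorem sum_le_add_mul_tailSum {n : ℕ} {p q : Fin n → ℝ} {a : ℝ} (h1 : ∀ i, q i ≤ 1)
    (ha : ∀ i, q i ≤ a * p i) (k : ℕ) : ∑ i, q i ≤ k + a * tailSum p k := by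
  set σ := Tuple.sort fun i => -p i
  have hcard : ((Finset.univ.filter fun j : Fin n => ¬ k ≤ (j : ℕ)).card : ℝ) ≤ k := by
    have := Fin.card_filter_val_lt (n := n) (m := k)
    simp only [not_le]
    rw [this]
    exact_mod_cast min_le_right _ _
  calc ∑ i, q i = ∑ j, q (σ j) := (Equiv.sum_comp σ q).symm
    _ ≤ ∑ j : Fin n, ((if ¬ k ≤ (j : ℕ) then 1 else 0) +
          a * if k ≤ (j : ℕ) then p (σ j) else 0) := by
        refine Finset.sum_le_sum fun j _ => ?_
        by_cases hj : k ≤ (j : ℕ)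
        · simpa [hj] using ha (σ j)
        · simpa [hj] using h1 (σ j)
    _ ≤ k + a * tailSum p k := by
        rw [Finset.sum_add_distrib, ← Finset.mul_sum, Finset.sum_boole]
        exact add_le_add_left hcard _

/-! ### Growth of the mean number of distinct contents, and the quantitative theorem. -/

section Requests

variable {P : Measure Ω} [IsProbabilityMeasure P]

omit [IsProbabilityMeasure P] in
theorem requestProb_of_nonpos {X : Ω → PointConfig} {t : ℝ} (ht : t ≤ 0) :
    requestProb P X t = 0 := by
  have : {ω | (X ω).RequestedIn (t : EReal)} = ∅ := by
    rw [eq_empty_iff_forall_notMem]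
    intro ω hω
    obtain ⟨x, -, hx1, hx2⟩ := requestedIn_iff.1 hω
    linarith
  rw [requestProb, this, measureReal_empty]

theorem requestProb_mono {X : Ω → PointConfig} {s t : ℝ} (hst : s ≤ t) :
    requestProb P X s ≤ requestProb P X t :=
  measureReal_mono fun _ h => RequestedIn.mono (by exact_mod_cast hst) h

theorem requestProb_le_rate_mul {X : Ω → PointConfig} (hX : IsStationaryPointProcess P X) {t : ℝ}
    (ht : 0 ≤ t) : requestProb P X t ≤ rate P X * t := by
  have h := requestProb_sub_le_rate_mul (X := fun _ : Unit => X) (i := ()) hX (t := 0) ht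
  rw [zero_add, requestProb_of_nonpos le_rfl, sub_zero] at h
  refine h.trans (mul_le_mul_of_nonneg_right ?_ ht)
  have := (hitTTL_mem_Icc (X := fun _ : Unit => X) (i := ()) hX 0).1
  nlinarith [hX.rate_pos]

theorem expectedDistinct_of_nonpos {ι : Type*} [Fintype ι] {X : ι → Ω → PointConfig}
    (hX : ∀ j, Measurable (X j)) {t : ℝ} (ht : t ≤ 0) : expectedDistinct P X t = 0 := by
  rw [expectedDistinct_eq_sum hX]
  exact Finset.sum_eq_zero fun j _ => requestProb_of_nonpos ht

variable {n : ℕ} {X : Fin n → Ω → PointConfig}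

/-- The contents whose mean number of requests during the characteristic time is below `z` still
receive a number of requests that is comparable to the cache size. -/
theorem mul_le_sum_rate_mul (hX : ∀ j, IsStationaryPointProcess P (X j)) {C T z κ₁ κ₂ γ : ℝ}
    (hC : 0 < C) (hT : expectedDistinct P X T = C) (hκ₁ : 0 < κ₁) (hκ₂ : 0 ≤ κ₂)
    (hγ : 0 < γ) (hq : ∀ j, z ≤ rate P (X j) * T → 1 / κ₁ ≤ requestProb P (X j) T)
    (htail : γ * tailSum (popularity P X) ⌊κ₂ * C⌋₊ < tailSum (popularity P X) ⌈κ₁ * C⌉₊) :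
    γ * (1 - κ₂) * C ≤ ∑ j with rate P (X j) * T < z, rate P (X j) * T := by
  have hT0 : 0 < T := by
    by_contra! h
    rw [expectedDistinct_of_nonpos (fun j => (hX j).measurable) h] at hT
    exact hC.ne hT
  have hK : ∑ j, requestProb P (X j) T = C := by
    rw [← expectedDistinct_eq_sum fun j => (hX j).measurable, hT]
  set Λ := ∑ j, rate P (X j)
  have hn : Nonempty (Fin n) := by
    by_contra h
    rw [not_nonempty_iff] at h
    rw [Finset.univ_eq_empty, Finset.sum_empty] at hK
    exact hC.ne hK
  have hΛ : 0 < Λ := Finset.sum_pos (fun j _ => (hX j).rate_pos) Finset.univ_nonempty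
  have ha : 0 < Λ * T := mul_pos hΛ hT0
  have hp (j : Fin n) : Λ * T * popularity P X j = rate P (X j) * T := by
    rw [popularity]
    change Λ * T * (rate P (X j) / Λ) = _
    field_simp
  have hp0 (j : Fin n) : 0 ≤ popularity P X j := div_nonneg (hX j).rate_pos.le hΛ.le
  have hθ (j : Fin n) : z / (Λ * T) ≤ popularity P X j ↔ z ≤ rate P (X j) * T := by
    rw [div_le_iff₀ ha, mul_comm, hp]
  -- Each content with $\lambda_jT\ge z$ contributes at least $1/\kappa_1$ to $K(T)=C$, so there are
  -- at most $\kappa_1C$ of them.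
  have hcard : (Finset.univ.filter fun j => z / (Λ * T) ≤ popularity P X j).card ≤
      ⌈κ₁ * C⌉₊ := by
    have h1 : ((Finset.univ.filter fun j => z / (Λ * T) ≤ popularity P X j).card : ℝ) * (1 / κ₁) ≤
        C := by
      rw [← hK, ← nsmul_eq_mul]
      refine (Finset.card_nsmul_le_sum _ (fun j => requestProb P (X j) T) _ fun j hj =>
        hq j ((hθ j).1 (Finset.mem_filter.1 hj).2)).trans ?_
      exact Finset.sum_le_sum_of_subset_of_nonneg (Finset.filter_subset _ _)
        fun j _ _ => requestProb_nonneg _ _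
    rw [mul_one_div, div_le_iff₀ hκ₁, mul_comm C] at h1
    exact_mod_cast h1.trans (Nat.le_ceil _)
  have h1 := tailSum_le_sum_lt hp0 hcard
  -- This reads $C\le\lfloor\kappa_2C\rfloor+\Lambda T\,\bar P(\lfloor\kappa_2C\rfloor)$, from
  -- $q_j\le1$ and $q_j\le\lambda_jT$.
  have h2 := sum_le_add_mul_tailSum (p := popularity P X) (a := Λ * T)
    (fun j => requestProb_le_one (P := P) (X j) T)
    (fun j => by rw [hp]; exact requestProb_le_rate_mul (hX j) hT0.le) ⌊κ₂ * C⌋₊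
  rw [hK] at h2
  have h3 := Nat.floor_le (mul_nonneg hκ₂ hC.le)
  have h4 : ∑ j with rate P (X j) * T < z, rate P (X j) * T =
      Λ * T * ∑ j with popularity P X j < z / (Λ * T), popularity P X j := by
    rw [Finset.mul_sum]
    refine Finset.sum_congr ?_ fun j _ => (hp j).symm
    refine Finset.filter_congr fun j _ => ?_
    rw [← not_le, ← not_le, hθ]
  rw [h4]
  calc γ * (1 - κ₂) * C = γ * (C - κ₂ * C) := by ring
    _ ≤ γ * (Λ * T * tailSum (popularity P X) ⌊κ₂ * C⌋₊) := by gcongr; linarith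
    _ = Λ * T * (γ * tailSum (popularity P X) ⌊κ₂ * C⌋₊) := by ring
    _ ≤ _ := by gcongr; exact htail.le.trans h1

/-- The growth of the expected number of distinct requested contents. -/
theorem add_mul_le_expectedDistinct (hX : ∀ j, IsStationaryPointProcess P (X j))
    {z v m s h : ℝ} (hs : 0 ≤ s) (hh : 0 ≤ h) (hv0 : 0 ≤ v)
    (hv : ∀ j, rate P (X j) * (s + h) ≤ z → v ≤ 1 - hitTTL P X (s + h) j)
    {J : Finset (Fin n)} (hJ : ∀ j ∈ J, rate P (X j) * (s + h) ≤ z)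
    (hm : m ≤ ∑ j ∈ J, rate P (X j) * h) :
    expectedDistinct P X s + v * m ≤ expectedDistinct P X (s + h) := by
  rw [expectedDistinct_eq_sum fun j => (hX j).measurable,
    expectedDistinct_eq_sum fun j => (hX j).measurable, ← le_sub_iff_add_le',
    ← Finset.sum_sub_distrib]
  calc v * m ≤ ∑ j ∈ J, v * (rate P (X j) * h) := by
        rw [← Finset.mul_sum]
        gcongr
    _ ≤ ∑ j ∈ J, (requestProb P (X j) (s + h) - requestProb P (X j) s) := by
        refine Finset.sum_le_sum fun j hj => ?_
        refine le_trans ?_ (rate_mul_le_requestProb_sub (hX j) hs hh)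
        have := mul_le_mul_of_nonneg_left (hv j (hJ j hj)) (mul_nonneg (hX j).rate_pos.le hh)
        linarith
    _ ≤ _ := Finset.sum_le_sum_of_subset_of_nonneg (Finset.subset_univ _) fun j _ _ =>
        sub_nonneg.2 (requestProb_mono (by linarith))

end Requests

/-- The rate of convergence under quantitative assumptions on the hit and request probabilities. -/
theorem isBigO_iSup_hitLRU_sub_hitTTL (P : Measure Ω) [IsProbabilityMeasure P]
    {X : (n : ℕ) → Fin n → Ω → PointConfig} (hindep : ∀ n, iIndepFun (X n) P)
    (hX : ∀ n i, IsStationaryPointProcess P (X n i)) {C T : ℕ → ℝ} (hC : Tendsto C atTop atTop)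
    (hT : ∀ᶠ n : ℕ in atTop, expectedDistinct P (X n) (T n) = C n)
    {z κ₁ κ₂ γ v x₀ B : ℝ} (hκ₁ : 0 < κ₁) (hκ₂ : κ₂ ∈ Ico (0 : ℝ) 1)
    (hγ : 0 < γ) (hv0 : 0 < v) (hx₀ : 0 < x₀) (hx₁ : x₀ ≤ 1)
    (hq : ∀ n i t, z ≤ rate P (X n i) * t → 1 / κ₁ ≤ requestProb P (X n i) t)
    (hv : ∀ n i t, 0 ≤ t → rate P (X n i) * t ≤ z * (1 + x₀) → v ≤ 1 - hitTTL P (X n) t i)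
    (hL : ∀ n i t x, 0 ≤ t → x ∈ Icc 0 x₀ → hitTTL P (X n) (t + x * t) i ≤
      hitTTL P (X n) t i + B * x ∧ hitTTL P (X n) t i - B * x ≤ hitTTL P (X n) (t - x * t) i)
    (htail : ∀ᶠ n : ℕ in atTop, γ * tailSum (popularity P (X n)) ⌊κ₂ * C n⌋₊ <
      tailSum (popularity P (X n)) ⌈κ₁ * C n⌉₊) :
    (fun n => ⨆ i : Fin n, |hitLRU P (X n) (C n) i - hitTTL P (X n) (T n) i|)
      =O[atTop] fun n => √(Real.log (C n) / C n) := by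
  -- The relative growth rate: scaling $T$ by $1\pm x$ moves $K$ by at least $c\,x\,C$.
  set c := v * (γ * (1 - κ₂)) with hc
  have hκ : 0 < 1 - κ₂ := sub_pos.2 hκ₂.2
  have hc0 : 0 < c := by positivity
  set s : ℕ → ℝ := fun n => √(Real.log (C n) / C n)
  have hs0 : Tendsto s atTop (𝓝 0) := by
    have h1 : Tendsto (fun x : ℝ => Real.log x / x) atTop (𝓝 0) :=
      Real.isLittleO_log_id_atTop.tendsto_div_nhds_zero
    have h2 := (Real.continuous_sqrt.tendsto 0).comp (h1.comp hC)
    rwa [Real.sqrt_zero] at h2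
  have hx : ∀ᶠ n in atTop, 6 / c * s n < x₀ := by
    have := hs0.const_mul (6 / c)
    rw [mul_zero] at this
    exact this.eventually_lt_const hx₀
  refine IsBigO.of_bound (|B| * (6 / c) + 1) ?_
  -- The bound $s<1/3$ gives $d\le C$, and $C\ge e$ gives $\log C\ge1$, whence $1/C\le s$ and
  -- $d\ge1$.
  filter_upwards [hT, htail, hx, hs0.eventually_lt_const (show (0 : ℝ) < 1 / 3 by norm_num),
    hC.eventually_ge_atTop (Real.exp 1)] with n hTn htn hxn hsn hCn
  have hC1 : 1 < C n := (Real.one_lt_exp_iff.2 one_pos).trans_le hCn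
  have hC0 : 0 < C n := one_pos.trans hC1
  have hlog : 1 ≤ Real.log (C n) := (Real.le_log_iff_exp_le hC0).2 hCn
  have hsC : s n ^ 2 * C n = Real.log (C n) := by
    rw [Real.sq_sqrt (by positivity)]
    field_simp
  have hsn0 : 0 ≤ s n := Real.sqrt_nonneg _
  have hCs : 1 / C n ≤ s n := by
    refine Real.le_sqrt_of_sq_le ?_
    rw [div_pow, one_pow, div_le_div_iff₀ (by positivity) hC0]
    nlinarith
  -- With $d=3sC$ the Chernoff exponent is $d^2/(8C)=\tfrac98\log C$, so the error is at most
  -- $1/C\le s$; $x$ solves $c\,x\,C=2d$.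
  set x := 6 / c * s n
  set d := 3 * s n * C n with hd
  have hx0 : 0 ≤ x := by positivity
  have hxd : c * x * C n = 2 * d := by
    rw [hd]
    simp only [x]
    field_simp
    ring
  have hd1 : 1 ≤ d := by
    rw [div_le_iff₀ hC0] at hCs
    linarith
  have hdC : d ≤ C n := by
    have := mul_le_mul_of_nonneg_right hsn.le hC0.le
    linarith
  have hexp : Real.exp (-(d ^ 2 / (8 * C n))) ≤ s n := by
    refine le_trans ?_ hCs
    rw [one_div, ← Real.exp_log (inv_pos.2 hC0), Real.log_inv, Real.exp_le_exp, neg_le_neg_iff,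
      le_div_iff₀ (by positivity)]
    have : d ^ 2 = 9 * Real.log (C n) * C n := by
      rw [← hsC, hd]
      ring
    nlinarith
  have hT0 : 0 < T n := by
    by_contra! h
    rw [expectedDistinct_of_nonpos (fun j => (hX n j).measurable) h] at hTn
    exact hC0.ne hTn
  have hmass := mul_le_sum_rate_mul (hX n) hC0 hTn hκ₁ hκ₂.1 hγ (fun j => hq n j _) htn
  set J := Finset.univ.filter fun j => rate P (X n j) * T n < z
  have hz (j) (hj : j ∈ J) : rate P (X n j) * T n < z := (Finset.mem_filter.1 hj).2
  have hm : γ * (1 - κ₂) * C n * x ≤ ∑ j ∈ J, rate P (X n j) * (x * T n) := by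
    refine (mul_le_mul_of_nonneg_right hmass hx0).trans_eq ?_
    rw [Finset.sum_mul]
    exact Finset.sum_congr rfl fun j _ => by ring
  have hvm : v * (γ * (1 - κ₂) * C n * x) = 2 * d := by
    rw [← hxd, hc]
    ring
  have hup : C n + 2 * d ≤ expectedDistinct P (X n) (T n + x * T n) := by
    rw [← hTn, ← hvm]
    refine add_mul_le_expectedDistinct (hX n) hT0.le (by positivity) hv0.le
      (fun j => hv n j _ (by positivity)) (J := J) (fun j hj => ?_) hm
    -- On $J$ the scaled time reaches at most $z(1+x)\le z(1+x_0)$, which is the range in which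
    -- survival is at least $v$.
    have h1 : rate P (X n j) * (T n + x * T n) = rate P (X n j) * T n * (1 + x) := by ring
    have h2 := (hX n j).rate_pos
    rw [h1]
    exact mul_le_mul (hz j hj).le (by linarith) (by positivity) ((by positivity : 0 ≤
      rate P (X n j) * T n).trans (hz j hj).le)
  have hlow : expectedDistinct P (X n) (T n - x * T n) ≤ C n - 2 * d := by
    rw [le_sub_iff_add_le, ← hvm]
    have h1 : 0 ≤ T n - x * T n := by nlinarith
    have h2 := add_mul_le_expectedDistinct (hX n) h1 (by positivity : 0 ≤ x * T n) hv0.le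
      (fun j => hv n j _ (by linarith)) (J := J) (fun j hj => ?_) hm
    · rwa [sub_add_cancel, hTn] at h2
    · rw [sub_add_cancel]
      have h3 := (hX n j).rate_pos
      have h4 : 0 < rate P (X n j) * T n := by positivity
      nlinarith [hz j hj]
  have hbound : |B| * x + s n = (|B| * (6 / c) + 1) * s n := by simp only [x]; ring
  have hBx : B * x ≤ |B| * x := mul_le_mul_of_nonneg_right (le_abs_self B) hx0
  rw [Real.norm_of_nonneg (Real.iSup_nonneg fun _ => abs_nonneg _), Real.norm_of_nonneg hsn0,
    ← hbound]
  refine Real.iSup_le (fun i => ?_) (by positivity)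
  have h1 := hitLRU_le_hitTTL_add (hX n) (hindep n) hd1 hdC hup i
  have h2 := hitTTL_sub_le_hitLRU (hX n) (hindep n) hd1 hdC hlow i
  have h3 := hL n i (T n) x hT0.le ⟨hx0, hxn.le⟩
  rw [abs_le]
  constructor <;> linarith [h3.1, h3.2]

/-! ### The general stationary and ergodic case. -/

theorem IsStationaryErgodic.isStationary {P : Measure Ω} {X : Ω → PointConfig}
    (hX : IsStationaryErgodic P X) : IsStationaryPointProcess P X where
  measurable := hX.measurable
  map_vadd t := by
    have := hX.ergodic
    ext A hA
    have hm : Measurable fun ω => t +ᵥ X ω := (measurable_vadd_const t).comp hX.measurable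
    rw [Measure.map_apply hm hA, ← VAddInvariantMeasure.measure_preimage_vadd (μ := P.map X) t hA,
      Measure.map_apply hX.measurable (measurable_vadd_const t hA)]
    rfl
  intensity_ne_zero := hX.intensity_ne_zero
  intensity_ne_top := hX.intensity_ne_top

/-- The request probability is bounded below by the integral of any decreasing lower bound on the
survival function of the inter-request times. -/
theorem integral_le_requestProb {P : Measure Ω} [IsProbabilityMeasure P] {ι : Type*}
    {X : ι → Ω → PointConfig} {i : ι} (hX : IsStationaryPointProcess P (X i)) {v : ℝ → ℝ}
    (hv : Antitone v) (hv0 : ∀ x, 0 ≤ v x) (hv1 : ∀ x, v x ≤ 1)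
    (h : ∀ t, v (rate P (X i) * t) ≤ 1 - hitTTL P X t i) {t : ℝ} (ht : 0 ≤ t) :
    ∫ x in 0..rate P (X i) * t, v x ≤ requestProb P (X i) t := by
  set w := rate P (X i) * t with hw
  have hw0 : 0 ≤ w := mul_nonneg hX.rate_pos.le ht
  have hint (a b : ℝ) : IntervalIntegrable v volume a b := hv.intervalIntegrable
  -- Cut $[0,t]$ into $M$ steps and add the finite-difference bounds. The sum over right endpoints
  -- dominates the integral over $[w/M,w+w/M]$; moving the interval back to $[0,w]$ costs at most
  -- $w/M$ because $0\le v\le1$.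
  have key (M : ℕ) (hM : 0 < M) : ∫ x in 0..w, v x ≤ requestProb P (X i) t + w / M := by
    have hM0 : (0 : ℝ) < M := by exact_mod_cast hM
    have hstep (k : ℕ) : w / M * v ((1 + k) * (w / M)) ≤
        requestProb P (X i) ((k + 1 : ℕ) * (t / M)) - requestProb P (X i) (k * (t / M)) := by
      have h1 := rate_mul_le_requestProb_sub hX (t := k * (t / M)) (h := t / M)
        (by positivity) (by positivity)
      have h2 : (k : ℝ) * (t / M) + t / M = (k + 1 : ℕ) * (t / M) := by push_cast; ring
      rw [h2] at h1
      refine le_trans ?_ h1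
      have h3 := h ((k + 1 : ℕ) * (t / M))
      have h4 : rate P (X i) * ((k + 1 : ℕ) * (t / M)) = (1 + k) * (w / M) := by
        rw [hw]
        push_cast
        ring
      rw [h4] at h3
      calc w / M * v ((1 + k) * (w / M))
          ≤ w / M * (1 - hitTTL P X ((k + 1 : ℕ) * (t / M)) i) := by gcongr
        _ = _ := by rw [hw]; ring
    have hsum := Finset.sum_le_sum fun k (_ : k ∈ Finset.range M) => hstep k
    rw [Finset.sum_range_sub fun k => requestProb P (X i) (k * (t / M)), Nat.cast_zero, zero_mul,
      requestProb_of_nonpos le_rfl, sub_zero, mul_div_cancel₀ _ hM0.ne', ← Finset.mul_sum] at hsum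
    have hanti : Antitone fun y => v (y * (w / M)) := fun a b hab =>
      hv (mul_le_mul_of_nonneg_right hab (by positivity))
    have hI := AntitoneOn.integral_le_sum (x₀ := 1) (a := M) (hanti.antitoneOn _)
    have hsub := intervalIntegral.smul_integral_comp_mul_right (a := 1) (b := 1 + M) v (w / M)
    have hI' : ∫ x in 1 * (w / M)..(1 + M) * (w / M), v x ≤ requestProb P (X i) t := by
      rw [← hsub, smul_eq_mul]
      exact (mul_le_mul_of_nonneg_left hI (by positivity)).trans hsum
    have he : (1 + M) * (w / M) = w + w / M := by field_simp; ring
    rw [one_mul, he] at hI'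
    have h5 : ∫ x in 0..w / M, v x ≤ w / M := by
      have := intervalIntegral.integral_mono_on (by positivity : 0 ≤ w / M) (hint 0 (w / M))
        (intervalIntegrable_const (c := (1 : ℝ))) fun x _ => hv1 x
      simpa using this
    have h6 : 0 ≤ ∫ x in w..w + w / M, v x :=
      intervalIntegral.integral_nonneg (by linarith [div_nonneg hw0 hM0.le]) fun x _ => hv0 x
    have h7 := intervalIntegral.integral_add_adjacent_intervals (hint 0 (w / M))
      (hint (w / M) (w + w / M))
    have h8 := intervalIntegral.integral_add_adjacent_intervals (hint 0 w) (hint w (w + w / M))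
    linarith
  have hlim : Tendsto (fun M : ℕ => requestProb P (X i) t + w / M) atTop
      (𝓝 (requestProb P (X i) t + 0)) :=
    (tendsto_const_div_atTop_nhds_zero_nat w).const_add _
  rw [add_zero] at hlim
  exact ge_of_tendsto hlim ((eventually_gt_atTop 0).mono key)

/-- The mean is $\int_0^\infty(1-\Psi)$, so the primitive of $1-\Psi$ passes through $a$ at some
$z$. If $\Psi(z)=1$, the primitive would stay at $a$ from there on, although it exceeds $a$ at a
later $w$. -/
theorem exists_cdf_lt_one_of_lt_integral (ψ : Measure ℝ) [IsProbabilityMeasure ψ]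
    (hψ : ψ (Iio 0) = 0) {a : ℝ} (ha : 0 < a) (ham : a < ∫ x, x ∂ψ) :
    ∃ z : ℝ, 0 < z ∧ a = ∫ x in 0..z, (1 - cdf ψ x) ∧ cdf ψ z < 1 := by
  have hanti : Antitone fun x => 1 - cdf ψ x := fun x y hxy =>
    sub_le_sub_left (monotone_cdf ψ hxy) 1
  have hint (a b : ℝ) : IntervalIntegrable (fun x => 1 - cdf ψ x) volume a b :=
    hanti.intervalIntegrable
  -- The integral of a non-integrable function is $0$ by convention, which contradicts $0<a<m_\Psi$.
  have hid : Integrable (fun x : ℝ => x) ψ := by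
    by_contra h
    rw [integral_undef h] at ham
    linarith
  have hnn : 0 ≤ᵐ[ψ] fun x : ℝ => x := by
    rw [Filter.EventuallyLE, ae_iff]
    convert hψ using 2
    ext x
    simp
  have hm := hid.integral_eq_integral_meas_lt hnn
  have hsurv (t : ℝ) : ψ.real {a | t < a} = 1 - cdf ψ t := by
    rw [cdf_eq_real, ← probReal_compl_eq_one_sub measurableSet_Iic, compl_Iic]
    rfl
  simp_rw [hsurv] at hm
  have hion : IntegrableOn (fun x => 1 - cdf ψ x) (Ioi 0) := by
    by_contra h
    rw [hm, integral_undef h] at ham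
    linarith
  have hlim := intervalIntegral_tendsto_integral_Ioi 0 hion tendsto_id
  rw [← hm] at hlim
  obtain ⟨w, hw, hw0⟩ := ((hlim.eventually_const_lt ham).and (eventually_ge_atTop 0)).exists
  simp only [id_eq] at hw
  obtain ⟨z, ⟨hz0, hzw⟩, hz⟩ := intermediate_value_Icc hw0
    (intervalIntegral.continuous_primitive hint 0).continuousOn
    (show a ∈ Icc _ _ from ⟨by simpa using ha.le, hw.le⟩)
  simp only at hz
  refine ⟨z, hz0.lt_of_ne ?_, hz.symm, ?_⟩
  · rintro rfl
    rw [intervalIntegral.integral_same] at hz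
    exact ha.ne hz
  · refine (cdf_le_one ψ z).lt_of_ne fun h1 => ?_
    have h2 := intervalIntegral.integral_add_adjacent_intervals (hint 0 z) (hint z w)
    have h3 : ∫ x in z..w, (1 - cdf ψ x) ≤ ∫ x in z..w, (0 : ℝ) :=
      intervalIntegral.integral_mono_on hzw (hint _ _) intervalIntegrable_const fun x hx => by
        have := monotone_cdf ψ hx.1
        linarith
    rw [intervalIntegral.integral_zero] at h3
    linarith

theorem isBigO_of_isStationaryErgodic (P : Measure Ω) [IsProbabilityMeasure P]
    {X : (n : ℕ) → Fin n → Ω → PointConfig} (hindep : ∀ n, iIndepFun (X n) P) {C T : ℕ → ℝ}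
    (hC : Tendsto C atTop atTop)
    (hT : ∀ᶠ n : ℕ in atTop, expectedDistinct P (X n) (T n) = C n)
    (hX : ∀ n i, IsStationaryErgodic P (X n i)) (ψ : Measure ℝ) [IsProbabilityMeasure ψ]
    (hψc : Continuous (cdf ψ)) (hψ : ψ (Iio 0) = 0) (hm : 0 < ∫ x, x ∂ψ)
    (hle : ∀ n i t, 1 - cdf ψ t ≤ 1 - scaledCdf P (X n) i t) {β₁ : ℝ}
    (htail : HeavyTail (∫ x, x ∂ψ) β₁ C (fun n => tailSum (popularity P (X n))))
    (hL : RelativeLipschitz {G | ∃ n i, G = scaledCdf P (X n) i}) :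
    (fun n => ⨆ i : Fin n, |hitLRU P (X n) (C n) i - hitTTL P (X n) (T n) i|)
      =O[atTop] fun n => √(Real.log (C n) / C n) := by
  have hX' (n i) := (hX n i).isStationary
  obtain ⟨κ₁, κ₂, γ, hκ₁, hκ₂, hγ, ht⟩ := htail
  obtain ⟨B, ρ, hρ0, hρ1, hB⟩ := hL
  have hκ₁0 : 0 < κ₁ := (one_div_pos.2 hm).trans hκ₁.1
  have hκ₁m : 1 / κ₁ < ∫ x, x ∂ψ := by
    rw [one_div_lt hκ₁0 hm]
    exact hκ₁.1
  obtain ⟨z, hz0, hz, hz1⟩ := exists_cdf_lt_one_of_lt_integral ψ hψ (one_div_pos.2 hκ₁0) hκ₁m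
  -- Continuity of $\Psi$ keeps survival positive slightly beyond $z$, which yields $x_0$; it is
  -- also taken at most $\rho$.
  have hcts : ContinuousAt (fun x : ℝ => cdf ψ (z * (1 + x))) 0 :=
    (hψc.comp (by fun_prop)).continuousAt
  have hlt : ∀ᶠ x : ℝ in 𝓝[>] 0, cdf ψ (z * (1 + x)) < 1 :=
    nhdsWithin_le_nhds (hcts.eventually_lt_const (by simpa using hz1))
  obtain ⟨x₀, hx₀, hx₀ρ⟩ := (hlt.and (Ioc_mem_nhdsGT hρ0)).exists
  have hscale (n i) (t : ℝ) : scaledCdf P (X n) i (rate P (X n i) * t) = hitTTL P (X n) t i := by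
    rw [scaledCdf, mul_div_cancel_left₀ _ (hX' n i).rate_pos.ne', hitTTL_eq_interCdf (hX' n i)]
  have hsurv (n i) (t : ℝ) : 1 - cdf ψ (rate P (X n i) * t) ≤ 1 - hitTTL P (X n) t i :=
    (hle n i _).trans_eq (by rw [hscale])
  refine isBigO_iSup_hitLRU_sub_hitTTL P hindep hX' hC hT (z := z) (v := 1 - cdf ψ (z * (1 + x₀)))
    (B := B) hκ₁0 hκ₂ hγ.1 (sub_pos.2 hx₀) hx₀ρ.1 (hx₀ρ.2.trans hρ1) (fun n i t hzt => ?_)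
    (fun n i t _ htz => ?_) (fun n i t x _ hx => ?_) ht
  · have ht0 : 0 ≤ t := by
      have := hz0.trans_le hzt
      exact (pos_of_mul_pos_right this (hX' n i).rate_pos.le).le
    have hanti : Antitone fun x => 1 - cdf ψ x := fun x y hxy =>
      sub_le_sub_left (monotone_cdf ψ hxy) 1
    have hnn (x : ℝ) : 0 ≤ 1 - cdf ψ x := sub_nonneg.2 (cdf_le_one ψ x)
    refine le_trans ?_ (integral_le_requestProb (hX' n i) hanti hnn
      (fun x => by linarith [cdf_nonneg ψ x]) (hsurv n i) ht0)
    have h1 := intervalIntegral.integral_add_adjacent_intervals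
      (hanti.intervalIntegrable (μ := volume) (a := 0) (b := z))
      (hanti.intervalIntegrable (μ := volume) (a := z) (b := rate P (X n i) * t))
    have h2 : 0 ≤ ∫ x in z..rate P (X n i) * t, (1 - cdf ψ x) :=
      intervalIntegral.integral_nonneg hzt fun x _ => hnn x
    linarith
  · exact (sub_le_sub_left (monotone_cdf ψ htz) 1).trans (hsurv n i t)
  · have h := hB _ ⟨n, i, rfl⟩ x ⟨hx.1, hx.2.trans hx₀ρ.2⟩ (rate P (X n i) * t)
    have e1 : rate P (X n i) * t + x * (rate P (X n i) * t) = rate P (X n i) * (t + x * t) := by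
      ring
    have e2 : rate P (X n i) * t - x * (rate P (X n i) * t) = rate P (X n i) * (t - x * t) := by
      ring
    rw [e1, e2, hscale, hscale, hscale, abs_le, abs_le] at h
    constructor <;> linarith [h.1.1, h.2.2]

/-! ### Void events generate the σ-algebra of configurations. -/

namespace PointConfig

/-- The sets of configurations without points in a given bounded Borel set. -/
def voidEvents : Set (Set PointConfig) :=
  {A | ∃ B : Set ℝ, MeasurableSet B ∧ Bornology.IsBounded B ∧ A = {S | S.carrier ∩ B = ∅}}

theorem isPiSystem_voidEvents : IsPiSystem voidEvents := by
  rintro _ ⟨B, hB, hBb, rfl⟩ _ ⟨B', hB', hBb', rfl⟩ -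
  refine ⟨B ∪ B', hB.union hB', hBb.union hBb', ?_⟩
  ext S
  simp [inter_union_distrib_left, union_empty_iff]

/-- The cell of points of `B` with a given integer part after scaling by `m`. -/
def cell (B : Set ℝ) (m : ℕ) (k : ℤ) : Set ℝ := B ∩ {x | ⌊x * (m + 1)⌋ = k}

theorem measurableSet_cell {B : Set ℝ} (hB : MeasurableSet B) (m : ℕ) (k : ℤ) :
    MeasurableSet (cell B m k) :=
  hB.inter ((Int.measurable_floor.comp (measurable_id.mul_const _)) (measurableSet_singleton k))

theorem isBounded_cell (B : Set ℝ) (m : ℕ) (k : ℤ) : Bornology.IsBounded (cell B m k) := by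
  refine (Metric.isBounded_Icc ((k : ℝ) / (m + 1)) ((k + 1) / (m + 1))).subset ?_
  rintro x ⟨-, hx⟩
  have hx' := Int.floor_eq_iff.1 hx
  have hm : (0 : ℝ) < m + 1 := by positivity
  exact ⟨(div_le_iff₀ hm).2 hx'.1, (le_div_iff₀ hm).2 hx'.2.le⟩

theorem iUnion_cell (B : Set ℝ) (m : ℕ) : ⋃ k, cell B m k = B := by
  ext x
  simp [cell]

-- The number of occupied cells never exceeds the number of points, and finitely many points lie in
-- different cells once the mesh $1/(m+1)$ is small.
open Classical in
theorem count_eq_iSup_tsum (S : PointConfig) {B : Set ℝ} (hB : MeasurableSet B) :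
    ((S.count B : ℕ∞) : ℝ≥0∞) =
      ⨆ m : ℕ, ∑' k : ℤ, if S.carrier ∩ cell B m k = ∅ then 0 else 1 := by
  refine le_antisymm ?_ (iSup_le fun m => ?_)
  · rw [count, ← ENNReal.tsum_set_one, ENNReal.tsum_eq_iSup_sum]
    refine iSup_le fun F => ?_
    have hinj : ∀ᶠ m : ℕ in atTop, ∀ x ∈ F, ∀ y ∈ F,
        ⌊(x : ℝ) * (m + 1)⌋ = ⌊(y : ℝ) * (m + 1)⌋ → x = y := by
      rw [Finset.eventually_all]
      intro x _
      rw [Finset.eventually_all]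
      intro y _
      by_cases hxy : x = y
      · exact Eventually.of_forall fun _ _ => hxy
      · have hpos : 0 < |(x : ℝ) - y| := abs_pos.2 (sub_ne_zero.2 fun h => hxy (Subtype.ext h))
        have hlim : Tendsto (fun m : ℕ => |(x : ℝ) - y| * ((m : ℝ) + 1)) atTop atTop :=
          (tendsto_natCast_atTop_atTop.atTop_add tendsto_const_nhds).const_mul_atTop hpos
        filter_upwards [hlim.eventually_ge_atTop 1] with m hm hfl
        have h := Int.abs_sub_lt_one_of_floor_eq_floor hfl
        rw [← sub_mul, abs_mul, abs_of_nonneg (by positivity : (0 : ℝ) ≤ m + 1)] at h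
        exact absurd h hm.not_gt
    obtain ⟨m, hm⟩ := hinj.exists
    refine le_trans ?_ (le_iSup _ m)
    set c : ↥(S.carrier ∩ B) → ℤ := fun x => ⌊(x : ℝ) * (m + 1)⌋
    refine le_trans (Eq.le ?_) (ENNReal.sum_le_tsum (F.image c))
    rw [Finset.sum_image fun x hx y hy h => hm x hx y hy h]
    refine Finset.sum_congr rfl fun x _ => ?_
    rw [if_neg]
    exact Nonempty.ne_empty ⟨x, x.2.1, x.2.2, rfl⟩
  · rw [← points_apply _ hB]
    rw [← congrArg S.points (iUnion_cell B m), measure_iUnion _ fun k => measurableSet_cell hB m k]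
    · refine ENNReal.tsum_le_tsum fun k => ?_
      split_ifs with h
      · exact zero_le
      · rw [points_apply _ (measurableSet_cell hB m k), ← ENat.toENNReal_one]
        exact ENat.toENNReal_mono (one_le_encard_iff_nonempty.2 (nonempty_iff_ne_empty.2 h))
    · intro k l hkl
      refine disjoint_left.2 fun x hx hx' => hkl ?_
      exact hx.2.symm.trans hx'.2

/-- Counts are suprema of sums of indicators of occupied bounded cells. Hence void probabilities
determine the law of a simple point process. -/
theorem generateFrom_voidEvents :
    (inferInstance : MeasurableSpace PointConfig) = MeasurableSpace.generateFrom voidEvents := by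
  classical
  refine le_antisymm (iSup₂_le fun B hB => ?_) (MeasurableSpace.generateFrom_le ?_)
  · have hm : Measurable[MeasurableSpace.generateFrom voidEvents]
        fun S : PointConfig => ((S.count B : ℕ∞) : ℝ≥0∞) := by
      simp_rw [count_eq_iSup_tsum _ hB]
      refine Measurable.iSup fun m => ?_
      refine @Measurable.tsum _ _ _ (MeasurableSpace.generateFrom voidEvents) _ _ _ _ _ _ _ _ _ _ _
        _ fun k => Measurable.ite ?_ measurable_const measurable_const
      exact MeasurableSpace.measurableSet_generateFrom
        ⟨_, measurableSet_cell hB m k, isBounded_cell B m k, rfl⟩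
    rintro _ ⟨s, -, rfl⟩
    have hs : MeasurableSet ((fun k : ℕ∞ => (k : ℝ≥0∞)) '' s) :=
      (s.to_countable.image _).measurableSet
    convert hm hs using 1
    ext a
    simp
  · rintro _ ⟨B, hB, -, rfl⟩
    convert measurableSet_preimage_count hB {0} using 1
    ext S
    simp [count]

end PointConfig

/-! ### Poisson processes: stationarity, exact formulas and the conclusion. -/

section Poisson

variable {P : Measure Ω} [IsProbabilityMeasure P] {X : Ω → PointConfig} {r : ℝ≥0}

omit [IsProbabilityMeasure P] in
theorem IsPoissonProcess.measure_void (hX : IsPoissonProcess P X r) {B : Set ℝ}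
    (hB : MeasurableSet B) (hBb : Bornology.IsBounded B) :
    P {ω | (X ω).carrier ∩ B = ∅} =
      ENNReal.ofReal (Real.exp (-(r * (volume B).toReal))) := by
  have h := hX.count_law B hB hBb 0
  rw [poissonMeasure_singleton] at h
  simp only [count, Nat.cast_zero, encard_eq_zero, pow_zero, mul_one, Nat.factorial_zero,
    Nat.cast_one, div_one] at h
  exact h

/-- The void probabilities $e^{-r|B|}$ are translation invariant, and void events form a generating
π-system. -/
theorem IsPoissonProcess.map_vadd (hX : IsPoissonProcess P X r) (t : ℝ) :
    P.map (fun ω => t +ᵥ X ω) = P.map X := by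
  have hm : Measurable fun ω => t +ᵥ X ω := (measurable_vadd_const t).comp hX.measurable
  have : IsProbabilityMeasure (P.map X) := Measure.isProbabilityMeasure_map hX.measurable.aemeasurable
  have : IsProbabilityMeasure (P.map fun ω => t +ᵥ X ω) :=
    Measure.isProbabilityMeasure_map hm.aemeasurable
  refine ext_of_generate_finite voidEvents generateFrom_voidEvents isPiSystem_voidEvents ?_
    (by simp)
  rintro A hA
  have hAm : MeasurableSet A :=
    generateFrom_voidEvents.symm.le A (MeasurableSpace.measurableSet_generateFrom hA)
  obtain ⟨B, hB, hBb, rfl⟩ := hA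
  rw [Measure.map_apply hm hAm, Measure.map_apply hX.measurable hAm]
  have hB' : MeasurableSet ((fun x : ℝ => t + x) ⁻¹' B) := measurable_const_add t hB
  have hBb' : Bornology.IsBounded ((fun x : ℝ => t + x) ⁻¹' B) :=
    (Isometry.antilipschitz (isometry_add_left t)).isBounded_preimage hBb
  have he : (fun ω => t +ᵥ X ω) ⁻¹' {S | S.carrier ∩ B = ∅} =
      {ω | (X ω).carrier ∩ (fun x : ℝ => t + x) ⁻¹' B = ∅} := by
    ext ω
    change (t +ᵥ X ω).carrier ∩ B = ∅ ↔ (X ω).carrier ∩ (fun x : ℝ => t + x) ⁻¹' B = ∅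
    rw [carrier_vadd, ← image_inter_preimage, image_eq_empty]
  rw [he, hX.measure_void hB' hBb', measure_preimage_add, ← hX.measure_void hB hBb]
  rfl

omit [IsProbabilityMeasure P] in
theorem IsPoissonProcess.intensity_eq (hX : IsPoissonProcess P X r) : intensity P X = r := by
  set N : Ω → ℕ := fun ω => ((X ω).count (Ioc 0 1)).toNat
  have hbdd := Metric.isBounded_Ioc (0 : ℝ) 1
  have hN (ω : Ω) : ((N ω : ℕ) : ℕ∞) = (X ω).count (Ioc 0 1) :=
    ENat.natCast_toNat ((X ω).count_ne_top hbdd)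
  have hNm : Measurable N := fun s _ => hX.measurable
    (measurableSet_preimage_count measurableSet_Ioc (ENat.toNat ⁻¹' s))
  have hmap : P.map N = poissonMeasure r := by
    refine Measure.ext_of_singleton fun k => ?_
    rw [Measure.map_apply hNm (measurableSet_singleton k)]
    have h := hX.count_law (Ioc 0 1) measurableSet_Ioc hbdd k
    rw [Real.volume_Ioc, sub_zero, ENNReal.ofReal_one, ENNReal.toNNReal_one, mul_one] at h
    rw [← h]
    congr 1
    ext ω
    change N ω = k ↔ (X ω).count (Ioc 0 1) = k
    rw [← hN, Nat.cast_inj]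
  have h1 : intensity P X = ∫⁻ k : ℕ, (k : ℝ≥0∞) ∂(poissonMeasure r) := by
    rw [← hmap, lintegral_map measurable_from_top hNm, intensity]
    refine lintegral_congr fun ω => ?_
    rw [← hN, ENat.toENNReal_coe]
  -- The identity $(k+1)\,\pi(k+1)=r\,\pi(k)$ turns the Poisson mean into $r$ times the total mass.
  have hstep (k : ℕ) : ((k + 1 : ℕ) : ℝ≥0∞) * poissonMeasure r {k + 1} =
      r * poissonMeasure r {k} := by
    rw [poissonMeasure_singleton, poissonMeasure_singleton, ← ENNReal.ofReal_natCast,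
      ← ENNReal.ofReal_coe_nnreal, ← ENNReal.ofReal_mul (by positivity),
      ← ENNReal.ofReal_mul (by positivity)]
    congr 1
    rw [Nat.factorial_succ, pow_succ]
    push_cast
    field_simp
  rw [h1, lintegral_countable', tsum_eq_zero_add' ENNReal.summable]
  simp_rw [hstep]
  rw [ENNReal.tsum_mul_left, Nat.cast_zero, zero_mul, zero_add]
  have h2 : ∑' k : ℕ, poissonMeasure r {k} = 1 := by
    have := lintegral_countable' (μ := poissonMeasure r) fun _ => 1
    simpa using this.symm
  rw [h2, mul_one]

theorem IsPoissonProcess.isStationary (hX : IsPoissonProcess P X r) (hr : 0 < r) :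
    IsStationaryPointProcess P X where
  measurable := hX.measurable
  map_vadd := hX.map_vadd
  intensity_ne_zero := by
    rw [hX.intensity_eq]
    exact_mod_cast hr.ne'
  intensity_ne_top := by
    rw [hX.intensity_eq]
    exact ENNReal.coe_ne_top

omit [IsProbabilityMeasure P] in
theorem IsPoissonProcess.rate_eq (hX : IsPoissonProcess P X r) : rate P X = r := by
  rw [rate, hX.intensity_eq, ENNReal.coe_toReal]

theorem IsPoissonProcess.requestProb_eq (hX : IsPoissonProcess P X r) {t : ℝ} (ht : 0 ≤ t) :
    requestProb P X t = 1 - Real.exp (-(r * t)) := by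
  have h := hX.measure_void (measurableSet_Ico (a := -t) (b := 0)) (Metric.isBounded_Ico _ _)
  rw [Real.volume_Ico, zero_sub, neg_neg, ENNReal.toReal_ofReal ht] at h
  have hm : MeasurableSet {ω | (X ω).RequestedIn (t : EReal)} :=
    hX.measurable (measurableSet_requestedIn t)
  have hc : {ω | (X ω).RequestedIn (t : EReal)}ᶜ = {ω | (X ω).carrier ∩ Ico (-t) 0 = ∅} := by
    ext ω
    change ¬ (X ω).RequestedIn (t : EReal) ↔ _
    rw [requestedIn_iff, not_nonempty_iff_eq_empty]
    rfl
  have h2 := probReal_compl_eq_one_sub (μ := P) hm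
  rw [hc, Measure.real, h, ENNReal.toReal_ofReal (Real.exp_nonneg _)] at h2
  rw [requestProb, h2]
  ring

/-- The finite-difference bounds squeeze $r(1-H(t))$ between difference quotients of
$q(t)=1-e^{-rt}$ to the right and to the left of $t$; both tend to $re^{-rt}$. -/
theorem IsPoissonProcess.hitTTL_eq {ι : Type*} {X : ι → Ω → PointConfig} {i : ι}
    (hX : IsPoissonProcess P (X i) r) (hr : 0 < r) {t : ℝ} (ht : 0 ≤ t) :
    hitTTL P X t i = 1 - Real.exp (-(r * t)) := by
  have hS := hX.isStationary hr
  have hr' : (0 : ℝ) < r := hr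
  -- The left quotient needs $t-h\ge0$, so $t=0$ is treated apart.
  rcases ht.eq_or_lt with rfl | ht0
  · have h : {c : ι → PointConfig | (c i).RequestedIn ((0 : ℝ) : EReal)} = ∅ := by
      rw [eq_empty_iff_forall_notMem]
      intro c hc
      obtain ⟨x, -, hx1, hx2⟩ := requestedIn_iff.1 hc
      linarith
    rw [hitTTL, h, palmProb]
    simp
  set E := Real.exp (-(r * t))
  have hE : 0 < E := Real.exp_pos _
  have hexp {y : ℝ} (hy : |y| ≤ 1) : Real.exp y - 1 ≤ y + y ^ 2 := by
    have := (abs_le.1 (Real.abs_exp_sub_one_sub_id_le hy)).2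
    linarith
  have hub (h : ℝ) (h0 : 0 < h) (hht : h ≤ t) (hh1 : r * h ≤ 1) :
      1 - hitTTL P X t i ≤ E * (1 + r * h) := by
    have h1 := rate_mul_le_requestProb_sub hS (t := t - h) (h := h) (by linarith) h0.le
    rw [sub_add_cancel, hX.rate_eq, hX.requestProb_eq ht, hX.requestProb_eq (by linarith)] at h1
    have h2 : Real.exp (-(r * (t - h))) = E * Real.exp (r * h) := by
      rw [← Real.exp_add]
      ring_nf
    have h3 := hexp (y := r * h) (abs_le.2 ⟨by nlinarith, hh1⟩)
    rw [h2] at h1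
    have h4 : (1 - hitTTL P X t i) * (r * h) ≤ E * (1 + r * h) * (r * h) := by
      calc _ ≤ E * (Real.exp (r * h) - 1) := by linarith
        _ ≤ E * (r * h + (r * h) ^ 2) := by gcongr
        _ = _ := by ring
    exact le_of_mul_le_mul_right h4 (by positivity)
  have hlb (h : ℝ) (h0 : 0 < h) (hh1 : r * h ≤ 1) :
      E * (1 - r * h) ≤ 1 - hitTTL P X t i := by
    have h1 := requestProb_sub_le_rate_mul hS (t := t) (h := h) h0.le
    rw [hX.rate_eq, hX.requestProb_eq ht, hX.requestProb_eq (by linarith)] at h1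
    have h2 : Real.exp (-(r * (t + h))) = E * Real.exp (-(r * h)) := by
      rw [← Real.exp_add]
      ring_nf
    have hp : 0 < r * h := by positivity
    have h3 := hexp (y := -(r * h)) (abs_le.2 ⟨by linarith, by linarith⟩)
    rw [h2] at h1
    have h4 : E * (1 - r * h) * (r * h) ≤ (1 - hitTTL P X t i) * (r * h) := by
      calc _ = E * (r * h - (-(r * h)) ^ 2) := by ring
        _ ≤ E * (1 - Real.exp (-(r * h))) := mul_le_mul_of_nonneg_left (by linarith) hE.le
        _ ≤ _ := by linarith
    exact le_of_mul_le_mul_right h4 hp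
  have hnear : ∀ᶠ h : ℝ in 𝓝[>] 0, 0 < h ∧ h ≤ t ∧ r * h ≤ 1 := by
    filter_upwards [Ioc_mem_nhdsGT ht0, Ioc_mem_nhdsGT (inv_pos.2 hr')] with h h1 h2
    refine ⟨h1.1, h1.2, ?_⟩
    rw [mul_comm]
    exact (le_inv_mul_iff₀' hr').1 (by simpa using h2.2)
  have hlim1 : Tendsto (fun h : ℝ => E * (1 + r * h)) (𝓝[>] 0) (𝓝 (E * (1 + r * 0))) :=
    (Continuous.tendsto (by fun_prop) 0).mono_left nhdsWithin_le_nhds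
  have hlim2 : Tendsto (fun h : ℝ => E * (1 - r * h)) (𝓝[>] 0) (𝓝 (E * (1 - r * 0))) :=
    (Continuous.tendsto (by fun_prop) 0).mono_left nhdsWithin_le_nhds
  rw [mul_zero, add_zero, mul_one] at hlim1
  rw [mul_zero, sub_zero, mul_one] at hlim2
  have g1 := ge_of_tendsto hlim1 (hnear.mono fun h hh => hub h hh.1 hh.2.1 hh.2.2)
  have g2 := le_of_tendsto hlim2 (hnear.mono fun h hh => hlb h hh.1 hh.2.2)
  linarith

end Poisson

/-- The quantitative theorem asks for stationarity and three bounds on $q$ and $H$, all of which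
follow from $q(t)=H(t)=1-e^{-rt}$. -/
theorem isBigO_of_isPoissonProcess (P : Measure Ω) [IsProbabilityMeasure P]
    {X : (n : ℕ) → Fin n → Ω → PointConfig} (hindep : ∀ n, iIndepFun (X n) P) {C T : ℕ → ℝ}
    (hC : Tendsto C atTop atTop)
    (hT : ∀ᶠ n : ℕ in atTop, expectedDistinct P (X n) (T n) = C n)
    (hX : ∀ n i, ∃ r : ℝ≥0, 0 < r ∧ IsPoissonProcess P (X n i) r) {β₁ : ℝ}
    (htail : HeavyTail 1 β₁ C (fun n => tailSum (popularity P (X n)))) :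
    (fun n => ⨆ i : Fin n, |hitLRU P (X n) (C n) i - hitTTL P (X n) (T n) i|)
      =O[atTop] fun n => √(Real.log (C n) / C n) := by
  obtain ⟨κ₁, κ₂, γ, hκ₁, hκ₂, hγ, ht⟩ := htail
  have hκ₁1 : 1 < κ₁ := by simpa using hκ₁.1
  have hκ₁0 : 0 < κ₁ := one_pos.trans hκ₁1
  choose r hr hr' using hX
  have hS (n i) := (hr' n i).isStationary (hr n i)
  have hκ : 0 < 1 - 1 / κ₁ := sub_pos.2 ((div_lt_one hκ₁0).2 hκ₁1)
  -- The solution of $1-e^{-z}=1/\kappa_1$.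
  set z := -Real.log (1 - 1 / κ₁) with hz
  have hz0 : 0 < z :=
    neg_pos.2 (Real.log_neg hκ (by linarith [one_div_pos.2 hκ₁0]))
  have hyexp (y : ℝ) : y * Real.exp (-y) ≤ 1 := by
    rw [Real.exp_neg, ← div_eq_mul_inv, div_le_one (Real.exp_pos _)]
    linarith [Real.add_one_le_exp y]
  refine isBigO_iSup_hitLRU_sub_hitTTL P hindep hS hC hT (z := z)
    (v := Real.exp (-(z * (1 + 1 / 2)))) (x₀ := 1 / 2) (B := 2) hκ₁0 hκ₂ hγ.1 (Real.exp_pos _)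
    (by norm_num) (by norm_num) (fun n i t hzt => ?_) (fun n i t ht0 htz => ?_)
    (fun n i t x ht0 hx => ?_) ht
  · have ht0 : 0 ≤ t := by
      have := hz0.trans_le hzt
      exact (pos_of_mul_pos_right this (hS n i).rate_pos.le).le
    rw [(hr' n i).rate_eq] at hzt
    rw [(hr' n i).requestProb_eq ht0]
    have h : Real.exp (-(r n i * t)) ≤ Real.exp (-z) := Real.exp_le_exp.2 (by linarith)
    rw [hz, neg_neg, Real.exp_log hκ] at h
    linarith
  · rw [(hr' n i).rate_eq] at htz
    rw [(hr' n i).hitTTL_eq (hr n i) ht0, sub_sub_cancel, Real.exp_le_exp]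
    linarith
  · have hr0 : (0 : ℝ) ≤ r n i := (r n i).2
    have hxt : 0 ≤ t - x * t := by nlinarith [hx.2]
    rw [(hr' n i).hitTTL_eq (hr n i) ht0, (hr' n i).hitTTL_eq (hr n i) hxt,
      (hr' n i).hitTTL_eq (hr n i) (add_nonneg ht0 (mul_nonneg hx.1 ht0))]
    set y : ℝ := r n i * t
    have hy0 : 0 ≤ y := mul_nonneg hr0 ht0
    have e1 : Real.exp (-(r n i * (t + x * t))) = Real.exp (-y) * Real.exp (-(x * y)) := by
      rw [← Real.exp_add]
      simp only [y]
      ring_nf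
    have e2 : Real.exp (-y) = Real.exp (-(r n i * (t - x * t))) * Real.exp (-(x * y)) := by
      rw [← Real.exp_add]
      simp only [y]
      ring_nf
    have h1 : 1 - Real.exp (-(x * y)) ≤ x * y := by linarith [Real.add_one_le_exp (-(x * y))]
    constructor
    · rw [e1]
      have h2 := mul_le_mul_of_nonneg_left h1 (Real.exp_nonneg (-y))
      have h3 := mul_le_mul_of_nonneg_left (hyexp y) hx.1
      linarith [hx.1]
    -- Since $x\le x_0=1/2$, the exponent $y(1-x)$ is at least $y/2$, and $ye^{-y/2}\le2$ explains
    -- $B=2$.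
    · have h4 : Real.exp (-(r n i * (t - x * t))) ≤ Real.exp (-(y / 2)) := by
        rw [Real.exp_le_exp]
        simp only [y]
        nlinarith [hx.2]
      have h5 : Real.exp (-(r n i * (t - x * t))) * (1 - Real.exp (-(x * y))) ≤
          Real.exp (-(y / 2)) * (x * y) :=
        mul_le_mul h4 h1 (by
          rw [sub_nonneg, Real.exp_le_one_iff]
          linarith [mul_nonneg hx.1 hy0]) (Real.exp_nonneg _)
      have h6 := mul_le_mul_of_nonneg_left (hyexp (y / 2)) hx.1
      linarith

end

theorem mainTheorem3 {Ω : Type*} [MeasurableSpace Ω] (P : Measure Ω) [IsProbabilityMeasure P]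
    -- request processes: `X n i` is the process of requests for content `i` among `n` contents
    (X : (n : ℕ) → Fin n → Ω → PointConfig)
    (hindep : ∀ n, iIndepFun (X n) P)
    -- cache sizes
    (C : ℕ → ℝ) (hCn : ∀ᶠ n : ℕ in atTop, 0 < C n ∧ C n < n) (hC : Tendsto C atTop atTop)
    -- characteristic times
    (T : ℕ → ℝ) (hT : ∀ᶠ n : ℕ in atTop, expectedDistinct P (X n) (T n) = C n) :
    -- general stationary and ergodic requests
    ((∀ n i, IsStationaryErgodic P (X n i)) →
      (∀ n i, Continuous (interCdf P (X n) i)) →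
      ∀ (ψ : Measure ℝ) [IsProbabilityMeasure ψ], Continuous (cdf ψ) → ψ (Iio 0) = 0 →
      0 < ∫ x, x ∂ψ →
      (∀ n i t, 1 - cdf ψ t ≤ 1 - scaledCdf P (X n) i t) →
      ∀ β₁ : ℝ, CacheSizeBound (∫ x, x ∂ψ) β₁ C →
      HeavyTail (∫ x, x ∂ψ) β₁ C (fun n => tailSum (popularity P (X n))) →
      RelativeLipschitz {G | ∃ n i, G = scaledCdf P (X n) i} →
      (fun n => ⨆ i : Fin n, |hitLRU P (X n) (C n) i - hitTTL P (X n) (T n) i|)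
        =O[atTop] fun n => √(Real.log (C n) / C n)) ∧
    -- Poisson requests
    ((∀ n i, ∃ r : ℝ≥0, 0 < r ∧ IsPoissonProcess P (X n i) r) →
      ∀ β₁ : ℝ, CacheSizeBound 1 β₁ C →
      HeavyTail 1 β₁ C (fun n => tailSum (popularity P (X n))) →
      (fun n => ⨆ i : Fin n, |hitLRU P (X n) (C n) i - hitTTL P (X n) (T n) i|)
        =O[atTop] fun n => √(Real.log (C n) / C n)) := by
  refine ⟨?_, ?_⟩
  · intro hX _ ψ _ hψc hψ hm hle β₁ _ htail hL
    exact isBigO_of_isStationaryErgodic P hindep hC hT hX ψ hψc hψ hm hle htail hL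
  · intro hX β₁ _ htail
    exact isBigO_of_isPoissonProcess P hindep hC hT hX htail
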